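/- Let $\alpha\ge\beta\ge-1/2$ be real numbers with $\alpha>-1/2$, and let $\mu$ be the measure on $[-1,1]$ given by $d\mu(x)=(1-x)^\alpha(1+x)^\beta\,dx$. Let $P_n=P_n^{(\alpha,\beta)}$ be the Jacobi polynomial of degree $n$, in the standard (Szegő) normalization $$P_n(x)=\frac1{n!}\sum_{k=0}^n\binom nk (n+\alpha+\beta+1)_k\,(\alpha+k+1)_{n-k}\Big(\frac{x-1}2\Big)^k,\qquad (a)_k=a(a+1)\cdots(a+k-1),$$ and put $h_n=\int_{-1}^1 P_n(x)^2\,d\mu(x)$. For $f\in L^1(\mu)$ put $c_n(f)=\int_{-1}^1 f(x)P_n(x)\,d\mu(x)$. For $\delta\ge0$ the Cesàro and Riesz means of order $\delta$ of the Jacobi expansion $\sum_{n\ge0} c_n(f)h_n^{-1}P_n(x)$ are $$\sigma_N^\delta f(x)=\sum_{n=0}^N\frac{A^\delta_{N-n}}{A^\delta_N}\,c_n(f)h_n^{-1}P_n(x)\quad(N=0,1,2,\dots),\qquad A_n^\delta=\binom{n+\delta}{n},$$ $$S_r^\delta f(x)=\sum_{0\le n<r}\Big(1-\frac nr\Big)^\delta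 c_n(f)h_n^{-1}P_n(x)\quad(r>0\text{ real}).$$ Suppose that $$1\le p<p_c=\frac{4(\alpha+1)}{2\alpha+3}\qquad\text{and}\qquad 0\le\delta<\frac{2\alpha+2}{p}-\frac{2\alpha+3}{2}.$$ Then there is a real-valued function $f\in L^p(\mu)$, supported in $[0,1]$, such that for almost every $x\in[-1,1]$ the means $\sigma_N^\delta f(x)$ do not converge to a finite limit as $N\to\infty$, and for almost every $x\in[-1,1]$ the means $S_r^\delta f(x)$ do not converge to a finite limit as $r\to\infty$. -/

import Mathlib

open MeasureTheory Filter Topology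

namespace JacobiExpansion

noncomputable section

/-- The number `A^δ_n`, the generalized binomial coefficient `n + δ` choose `n`. -/
def cesaroNumber (δ : ℝ) (n : ℕ) : ℝ := Ring.choose ((n : ℝ) + δ) n

/-- The `N`-th Cesàro mean of order `δ` of the series with terms `u 0, u 1, …`. -/
def cesaroMean (δ : ℝ) (u : ℕ → ℝ) (N : ℕ) : ℝ :=
  ∑ n ∈ Finset.range (N + 1), cesaroNumber δ (N - n) / cesaroNumber δ N * u n

/-- The Riesz mean of order `δ` and parameter `r > 0` of the series with terms `u 0, u 1, …`.
The index set consists of the natural numbers `n` with `n < r`. -/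
def rieszMean (δ : ℝ) (u : ℕ → ℝ) (r : ℝ) : ℝ :=
  ∑ n ∈ Finset.range ⌈r⌉₊, (1 - (n : ℝ) / r) ^ δ * u n

/-- The Jacobi weight `(1 - x)^α (1 + x)^β dx` on `[-1, 1]`. -/
def jacobiMeasure (α β : ℝ) : Measure ℝ :=
  (volume.restrict (Set.Icc (-1) 1)).withDensity
    (fun x => ENNReal.ofReal ((1 - x) ^ α * (1 + x) ^ β))

/-- The Jacobi polynomial of degree `n` (Szegő's normalization), by its explicit expansion
`(1 / n!) ∑ₖ (n choose k) (n + α + β + 1)ₖ (α + k + 1)ₙ₋ₖ ((x - 1) / 2)ᵏ`,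
where `(a)ₖ = a (a + 1) ⋯ (a + k - 1)`. -/
def jacobiPoly (α β : ℝ) (n : ℕ) : Polynomial ℝ :=
  ∑ k ∈ Finset.range (n + 1),
    Polynomial.C ((n.choose k : ℝ) * (ascPochhammer ℝ k).eval ((n : ℝ) + α + β + 1) *
        (ascPochhammer ℝ (n - k)).eval (α + (k : ℝ) + 1) / (n.factorial : ℝ)) *
      (Polynomial.C (1 / 2 : ℝ) * (Polynomial.X - 1)) ^ k

/-- The squared `L²(μ)` norm `h_n` of the `n`-th Jacobi polynomial. -/
def jacobiNormSq (α β : ℝ) (n : ℕ) : ℝ :=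
  ∫ x, (jacobiPoly α β n).eval x ^ 2 ∂(jacobiMeasure α β)

/-- The coefficient `c_n(f)` of `f` with respect to the `n`-th Jacobi polynomial. -/
def jacobiCoeff (α β : ℝ) (f : ℝ → ℝ) (n : ℕ) : ℝ :=
  ∫ x, f x * (jacobiPoly α β n).eval x ∂(jacobiMeasure α β)

/-- The `n`-th term `c_n(f) h_n⁻¹ P_n(x)` of the Jacobi expansion of `f` at `x`. -/
def jacobiTerm (α β : ℝ) (f : ℝ → ℝ) (x : ℝ) (n : ℕ) : ℝ :=
  jacobiCoeff α β f n * (jacobiNormSq α β n)⁻¹ * (jacobiPoly α β n).eval x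

end

end JacobiExpansion

/-!
# Divergent Cesàro and Riesz means of Jacobi expansions

If the Cesàro or Riesz means of order `δ` of a series converge, its terms are `O(n ^ δ)`
(`exists_abs_le_of_tendsto_cesaroMean`, `exists_abs_le_of_tendsto_rieszMean`). So it is enough to
find `f ∈ L^p`, supported in `[0, 1]`, for which the terms `c_n(f) h_n⁻¹ P_n(x)` are `O(n ^ δ)` only
for `x` in a null set.

In the variable `θ`, with `x = cos θ`, the Jacobi polynomial times the square root of the weight
solves `u'' + (N² + V) u = 0`, where `N = n + (α + β + 1) / 2` and `V` has inverse square
singularities at the end points. The energy `u'² + N² u²` is therefore constant up to bounded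
factors at distance at least of order `1 / N` from the end points (`IsOscillation.energy_le`).
Within that distance the coefficients of the hypergeometric equation show that `P_n` is comparable
with its value at the end point (`IsHypergeometric.abs_eval_sub_le`). Matching the two regimes shows
that `u` is bounded on all of `(0, π)` by a multiple of `D = (3 N) ^ (-α - 1/2) P_n(1)` and
oscillates inside with an amplitude of at least this order (`exists_jacobiWave_bounds`); in
particular `h_n = O(D²)`. All estimates are relative to `P_n(1)`, so that neither the value of
`P_n(1)` nor that of `h_n`, nor orthogonality, is needed.

Away from the end points `u` is a pure oscillation of frequency `N` up to a relative error
`O(1 / N)`, and by the Riemann–Lebesgue lemma it cannot be small on a set of positive measure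
(`eventually_amplitude_le`). As in the Cantor–Lebesgue theorem it follows that terms which are
`O(n ^ δ)` on a set of positive measure force `c_n(f) = O(n ^ δ D)` (`exists_abs_jacobiCoeff_le`).

On the other hand `P_n ≥ P_n(1) / 2` on an interval of length of order `n⁻²` next to `1`, of measure
of order `n ^ (-2 α - 2)`. Testing on the indicator function of such an interval bounds from below
the norm of `c_n` as a functional on `L^p([0, 1])`, and for
`δ < (2 α + 2) / p - (2 α + 3) / 2` this norm is not `O(n ^ δ D)`. The principle of uniform
boundedness provides `f` (`exists_memLp_not_abs_jacobiCoeff_le`).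
-/

namespace JacobiExpansion

/-! ### Terms of a Cesàro summable series -/

lemma cesaroNumber_eq_multichoose (δ : ℝ) (n : ℕ) :
    cesaroNumber δ n = Ring.multichoose (δ + 1) n := by
  rw [Ring.multichoose_eq, cesaroNumber]
  congr 1
  ring

lemma cesaroNumber_zero (δ : ℝ) : cesaroNumber δ 0 = 1 := by
  simp [cesaroNumber]

lemma cesaroNumber_succ (δ : ℝ) (n : ℕ) :
    cesaroNumber δ (n + 1) = cesaroNumber δ n * ((n + 1 + δ) / (n + 1)) := by
  have key : ∀ m : ℕ, (m.factorial : ℝ) * cesaroNumber δ m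
      = (ascPochhammer ℝ m).eval (δ + 1) := by
    intro m
    rw [cesaroNumber_eq_multichoose, ← nsmul_eq_mul,
      Ring.factorial_nsmul_multichoose_eq_ascPochhammer,
      Polynomial.ascPochhammer_smeval_eq_eval]
  have h1 := key (n + 1)
  have h0 := key n
  rw [ascPochhammer_succ_eval, ← h0, Nat.factorial_succ] at h1
  push_cast at h1
  have hf : (n.factorial : ℝ) ≠ 0 := by exact_mod_cast n.factorial_ne_zero
  have hn : (n + 1 : ℝ) ≠ 0 := by positivity
  rw [mul_div_assoc', eq_div_iff hn]
  apply mul_left_cancel₀ hf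
  linear_combination h1

lemma cesaroNumber_pos {δ : ℝ} (hδ : 0 ≤ δ) (n : ℕ) : 0 < cesaroNumber δ n := by
  induction n with
  | zero => simp [cesaroNumber_zero]
  | succ n ih => rw [cesaroNumber_succ]; positivity

lemma cesaroNumber_mono {δ : ℝ} (hδ : 0 ≤ δ) : Monotone (cesaroNumber δ) := by
  refine monotone_nat_of_le_succ fun n => ?_
  rw [cesaroNumber_succ]
  refine le_mul_of_one_le_right (cesaroNumber_pos hδ n).le ?_
  rw [one_le_div (by positivity)]
  linarith

/-- The numbers `A^δ_n` grow at most like `n ^ δ`: the product `∏ (1 + δ / j)` is controlled by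
`exp (δ ∑ 1 / j)` and the harmonic sum by a logarithm. -/
lemma cesaroNumber_le {δ : ℝ} (hδ : 0 ≤ δ) (n : ℕ) :
    cesaroNumber δ n ≤ Real.exp δ * ((n : ℝ) + 1) ^ δ := by
  have h1 : cesaroNumber δ n ≤ Real.exp (δ * (harmonic n : ℝ)) := by
    induction n with
    | zero => simp [cesaroNumber_zero]
    | succ n ih =>
      rw [cesaroNumber_succ, harmonic_succ]
      push_cast
      rw [mul_add, Real.exp_add]
      have hn : (0 : ℝ) < n + 1 := by positivity
      have h2 : ((n : ℝ) + 1 + δ) / (n + 1) ≤ Real.exp (δ * ((n : ℝ) + 1)⁻¹) := by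
        have := Real.add_one_le_exp (δ * ((n : ℝ) + 1)⁻¹)
        refine le_trans (le_of_eq ?_) this
        field_simp
        ring
      exact mul_le_mul ih h2 (by positivity) (Real.exp_pos _).le
  have h3 : (harmonic n : ℝ) ≤ 1 + Real.log ((n : ℝ) + 1) := by
    refine (harmonic_le_one_add_log n).trans ?_
    rcases Nat.eq_zero_or_pos n with rfl | hn
    · simp
    · have : (0 : ℝ) < n := by exact_mod_cast hn
      gcongr
      linarith
  refine h1.trans ?_
  rw [Real.rpow_def_of_pos (by positivity), ← Real.exp_add]
  apply Real.exp_le_exp.2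
  nlinarith

lemma abs_choose_succ_mul (s : ℝ) (k : ℕ) :
    |Ring.choose s (k + 1)| * (k + 1) = |s - k| * |Ring.choose s k| := by
  have h := Ring.choose_smul_choose s (Nat.le_succ k)
  rw [Nat.succ_eq_add_one, Nat.choose_succ_self_right, Nat.add_sub_cancel_left,
    Ring.choose_one_right, nsmul_eq_mul] at h
  have h2 : |(((k + 1 : ℕ) : ℝ)) * Ring.choose s (k + 1)| = |Ring.choose s k * (s - k)| := by
    rw [h]
  rw [abs_mul, abs_mul, abs_of_nonneg (by positivity : (0 : ℝ) ≤ ((k + 1 : ℕ) : ℝ))] at h2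
  push_cast at h2
  linarith

/-- The binomial series at radius one converges absolutely for a positive exponent. From the
index `k ≥ s` on, the terms telescope: `s |c k| = k |c k| - (k + 1) |c (k + 1)|`. -/
lemma exists_sum_abs_choose_le {s : ℝ} (hs : 0 < s) :
    ∃ C, ∀ n, ∑ k ∈ Finset.range n, |Ring.choose s k| ≤ C := by
  obtain ⟨k₀, hk₀⟩ := exists_nat_ge s
  have key : ∀ m : ℕ, s * ∑ k ∈ Finset.range (k₀ + m), |Ring.choose s k|
      + (k₀ + m : ℝ) * |Ring.choose s (k₀ + m)|
      = s * ∑ k ∈ Finset.range k₀, |Ring.choose s k| + k₀ * |Ring.choose s k₀| := by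
    intro m
    induction m with
    | zero => simp
    | succ m ih =>
      rw [← ih, ← add_assoc, Finset.sum_range_succ]
      have h := abs_choose_succ_mul s (k₀ + m)
      rw [abs_of_nonpos (a := s - _) (by push_cast; linarith [(m.cast_nonneg : (0 : ℝ) ≤ m)])] at h
      push_cast at h ⊢
      linear_combination h
  refine ⟨(s * ∑ k ∈ Finset.range k₀, |Ring.choose s k| + k₀ * |Ring.choose s k₀|) / s,
    fun n => ?_⟩
  rw [le_div_iff₀ hs, ← key n]
  have h1 : ∑ k ∈ Finset.range n, |Ring.choose s k|
      ≤ ∑ k ∈ Finset.range (k₀ + n), |Ring.choose s k| :=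
    Finset.sum_le_sum_of_subset_of_nonneg (Finset.range_mono (Nat.le_add_left _ _))
      fun _ _ _ => abs_nonneg _
  have h2 : (0 : ℝ) ≤ (k₀ + n : ℝ) * |Ring.choose s (k₀ + n)| := by positivity
  nlinarith

/-- Inversion of the Cesàro transform: the generating function of the numbers `A^δ_n` is
`(1 - X) ^ (-δ - 1)`, so that it is undone by convolution with the coefficients of
`(1 - X) ^ (δ + 1)`. -/
lemma eq_sum_choose_mul_cesaroMean {δ : ℝ} (hδ : 0 ≤ δ) (u : ℕ → ℝ) (N : ℕ) :
    u N = ∑ ij ∈ Finset.HasAntidiagonal.antidiagonal N, ((-1) ^ ij.1 * Ring.choose (δ + 1) ij.1) *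
      (cesaroNumber δ ij.2 * cesaroMean δ u ij.2) := by
  set d : PowerSeries ℝ := PowerSeries.mk fun k => (-1) ^ k * Ring.choose (δ + 1) k
  set A : PowerSeries ℝ := PowerSeries.mk (cesaroNumber δ)
  have hS : PowerSeries.mk (fun j => cesaroNumber δ j * cesaroMean δ u j)
      = A * PowerSeries.mk u := by
    ext n
    rw [PowerSeries.coeff_mk, mul_comm A, PowerSeries.coeff_mul,
      Finset.Nat.sum_antidiagonal_eq_sum_range_succ_mk, cesaroMean, Finset.mul_sum]
    refine Finset.sum_congr rfl fun k _ => ?_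
    simp only [A, PowerSeries.coeff_mk]
    field_simp [(cesaroNumber_pos hδ n).ne']
  have hd : d * A = 1 := by
    ext n
    rw [PowerSeries.coeff_mul, PowerSeries.coeff_one]
    have h := Ring.add_choose_eq n (Commute.all (δ + 1) (-(δ + 1)))
    rw [add_neg_cancel, Ring.choose_zero_ite] at h
    have h2 : (if n = 0 then (1 : ℝ) else 0) = (-1) ^ n * if n = 0 then (1 : ℝ) else 0 := by
      split_ifs with hn <;> simp [hn]
    rw [h2, h, Finset.mul_sum]
    refine Finset.sum_congr rfl fun ij hij => ?_
    rw [Finset.HasAntidiagonal.mem_antidiagonal] at hij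
    simp only [d, A, PowerSeries.coeff_mk]
    rw [Ring.choose_neg', cesaroNumber_eq_multichoose, ← hij, pow_add]
    have h3 : Int.negOnePow (ij.2 : ℤ) • Ring.multichoose (δ + 1) ij.2
        = (-1) ^ ij.2 * Ring.multichoose (δ + 1) ij.2 := by
      rw [Units.smul_def, zsmul_eq_mul, Int.coe_negOnePow_natCast]
      push_cast
      rfl
    rw [h3]
    have h4 : ((-1 : ℝ) ^ ij.2) * (-1) ^ ij.2 = 1 := by
      rw [← mul_pow]; simp
    linear_combination (-(-1) ^ ij.1 * Ring.choose (δ + 1) ij.1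
      * Ring.multichoose (δ + 1) ij.2) * h4
  have h5 : PowerSeries.mk u = d * PowerSeries.mk
      (fun j => cesaroNumber δ j * cesaroMean δ u j) := by
    rw [hS, ← mul_assoc, hd, one_mul]
  have h6 := congrArg (PowerSeries.coeff N) h5
  rw [PowerSeries.coeff_mul] at h6
  simpa [d] using h6

/-- The terms of a series with bounded Cesàro means of order `δ` are `O(n ^ δ)`. -/
lemma exists_abs_le_of_abs_cesaroMean_le {δ : ℝ} (hδ : 0 ≤ δ) {u : ℕ → ℝ} {B : ℝ}
    (hB : ∀ N, |cesaroMean δ u N| ≤ B) :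
    ∃ M, ∀ n : ℕ, |u n| ≤ M * ((n : ℝ) + 1) ^ δ := by
  obtain ⟨C, hC⟩ := exists_sum_abs_choose_le (by linarith : 0 < δ + 1)
  have hB0 : 0 ≤ B := (abs_nonneg _).trans (hB 0)
  refine ⟨C * (Real.exp δ * B), fun n => ?_⟩
  rw [eq_sum_choose_mul_cesaroMean hδ u n]
  have h1 : ∀ ij ∈ Finset.HasAntidiagonal.antidiagonal n, |((-1) ^ ij.1 * Ring.choose (δ + 1) ij.1) *
      (cesaroNumber δ ij.2 * cesaroMean δ u ij.2)|
      ≤ |Ring.choose (δ + 1) ij.1| * (Real.exp δ * ((n : ℝ) + 1) ^ δ * B) := by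
    intro ij hij
    have hle : ij.2 ≤ n := Finset.HasAntidiagonal.antidiagonal.snd_le hij
    have hA : cesaroNumber δ ij.2 ≤ Real.exp δ * ((n : ℝ) + 1) ^ δ :=
      (cesaroNumber_mono hδ hle).trans (cesaroNumber_le hδ n)
    rw [abs_mul, abs_mul, abs_mul, abs_pow, abs_neg, abs_one, one_pow, one_mul,
      abs_of_pos (cesaroNumber_pos hδ _)]
    gcongr
    exact hB _
  refine (Finset.abs_sum_le_sum_abs _ _).trans ((Finset.sum_le_sum h1).trans ?_)
  rw [← Finset.sum_mul, Finset.Nat.sum_antidiagonal_eq_sum_range_succ_mk]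
  calc _ ≤ C * (Real.exp δ * ((n : ℝ) + 1) ^ δ * B) := by
        gcongr
        exact hC _
    _ = _ := by ring

lemma exists_abs_le_of_tendsto_cesaroMean {δ : ℝ} (hδ : 0 ≤ δ) {u : ℕ → ℝ} {l : ℝ}
    (h : Tendsto (cesaroMean δ u) atTop (𝓝 l)) :
    ∃ M, ∀ n : ℕ, |u n| ≤ M * ((n : ℝ) + 1) ^ δ := by
  obtain ⟨B, hB⟩ := (Metric.isBounded_range_of_tendsto _ h).exists_norm_le
  exact exists_abs_le_of_abs_cesaroMean_le hδ fun N => hB _ (Set.mem_range_self N)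

/-! ### Terms of a Riesz summable series -/

/-- The truncated power `t₊ ^ e`, equal to `t ^ e` for `t > 0` and to `0` for `t ≤ 0` (also when
`e = 0`, so that the Riesz sums of order zero range over `n < r`). -/
noncomputable def posPow (e t : ℝ) : ℝ := if 0 < t then t ^ e else 0

lemma posPow_of_pos {e t : ℝ} (ht : 0 < t) : posPow e t = t ^ e := if_pos ht

lemma posPow_of_nonpos {e t : ℝ} (ht : t ≤ 0) : posPow e t = 0 := if_neg ht.not_gt

lemma posPow_nonneg (e t : ℝ) : 0 ≤ posPow e t := by
  rcases lt_or_ge 0 t with ht | ht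
  · rw [posPow_of_pos ht]; positivity
  · rw [posPow_of_nonpos ht]

lemma measurable_posPow (e : ℝ) : Measurable (posPow e) :=
  Measurable.ite measurableSet_Ioi (by fun_prop) measurable_const

lemma intervalIntegrable_posPow {e : ℝ} (he : -1 < e) (a b : ℝ) :
    IntervalIntegrable (posPow e) volume a b := by
  refine (intervalIntegral.intervalIntegrable_rpow' he (a := a) (b := b)).mono_fun
    (measurable_posPow e).aestronglyMeasurable (ae_of_all _ fun t => ?_)
  rcases lt_or_ge 0 t with ht | ht
  · simp only [posPow_of_pos ht, le_refl]
  · simp [posPow_of_nonpos ht]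

lemma integrable_posPow_mul_posPow {γ δ : ℝ} (hγ : -1 < γ) (hδ : 0 ≤ δ) (t m : ℝ) :
    Integrable fun s => posPow γ (t - s) * posPow δ (s - m) := by
  rcases le_total t m with h | h
  · refine (integrable_zero ℝ ℝ volume).congr (ae_of_all _ fun s => ?_)
    rcases le_total s m with hs | hs
    · simp [posPow_of_nonpos (sub_nonpos.2 hs)]
    · simp [posPow_of_nonpos (sub_nonpos.2 (h.trans hs))]
  have h1 : IntervalIntegrable (fun s => posPow γ (t - s)) volume m t := by
    have := (intervalIntegrable_posPow hγ (t - m) 0).comp_sub_left t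
    simpa using this
  rw [intervalIntegrable_iff_integrableOn_Ioc_of_le h] at h1
  have h2 : Integrable (fun s => (t - m) ^ δ * (Set.Ioc m t).indicator
      (fun s => posPow γ (t - s)) s) := (h1.integrable_indicator measurableSet_Ioc).const_mul _
  refine h2.mono' ?_ (ae_of_all _ fun s => ?_)
  · exact (((measurable_posPow γ).comp (by fun_prop : Measurable fun s : ℝ => t - s)).mul
      ((measurable_posPow δ).comp (by fun_prop : Measurable fun s : ℝ => s - m))).aestronglyMeasurable
  · rw [Real.norm_of_nonneg (mul_nonneg (posPow_nonneg _ _) (posPow_nonneg _ _))]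
    by_cases hs : s ∈ Set.Ioc m t
    · rw [Set.indicator_of_mem hs, mul_comm, posPow_of_pos (sub_pos.2 hs.1)]
      refine mul_le_mul_of_nonneg_right ?_ (posPow_nonneg _ _)
      exact Real.rpow_le_rpow (sub_pos.2 hs.1).le (by linarith [hs.2]) hδ
    · rw [Set.indicator_of_notMem hs]
      rw [Set.mem_Ioc, not_and_or, not_lt, not_le] at hs
      rcases hs with hs | hs
      · simp [posPow_of_nonpos (sub_nonpos.2 hs)]
      · simp [posPow_of_nonpos (sub_nonpos.2 hs.le)]

/-- The convolution of two truncated powers is a multiple of a truncated power. -/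
lemma integral_posPow_mul_posPow (γ δ t m : ℝ) :
    ∫ s, posPow γ (t - s) * posPow δ (s - m)
      = (∫ s, posPow γ (1 - s) * posPow δ s) * posPow (γ + δ + 1) (t - m) := by
  have h1 : ∫ s, posPow γ (t - s) * posPow δ (s - m)
      = ∫ s, posPow γ ((t - m) - s) * posPow δ s := by
    rw [← integral_add_right_eq_self _ m]
    congr 1 with s
    rw [add_sub_cancel_right, sub_sub, add_comm m s]
  rw [h1]
  rcases lt_or_ge 0 (t - m) with h | h
  · set τ := t - m
    have h2 := Measure.integral_comp_mul_left (fun s => posPow γ (τ - s) * posPow δ s) τ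
    have h3 : ∀ s, posPow γ (τ - τ * s) * posPow δ (τ * s)
        = τ ^ (γ + δ) * (posPow γ (1 - s) * posPow δ s) := by
      intro s
      rcases le_or_gt s 0 with hs | hs
      · rw [posPow_of_nonpos hs, posPow_of_nonpos (mul_nonpos_of_nonneg_of_nonpos h.le hs)]
        simp
      rcases le_or_gt 1 s with hs1 | hs1
      · rw [posPow_of_nonpos (by linarith : 1 - s ≤ 0), posPow_of_nonpos (by nlinarith)]
        simp
      have hs1' : 0 < 1 - s := by linarith
      rw [show τ - τ * s = τ * (1 - s) by ring, posPow_of_pos (by positivity),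
        posPow_of_pos (by positivity), posPow_of_pos hs, posPow_of_pos hs1',
        Real.mul_rpow h.le hs1'.le, Real.mul_rpow h.le hs.le, Real.rpow_add h]
      ring
    simp_rw [h3] at h2
    rw [integral_const_mul, abs_of_pos (inv_pos.2 h), smul_eq_mul] at h2
    rw [posPow_of_pos h, Real.rpow_add_one h.ne']
    have h4 : ∫ s, posPow γ (τ - s) * posPow δ s
        = τ * (τ⁻¹ * ∫ s, posPow γ (τ - s) * posPow δ s) := by
      field_simp
    rw [h4, ← h2]
    ring
  · rw [posPow_of_nonpos h, mul_zero]
    refine integral_eq_zero_of_ae (ae_of_all _ fun s => ?_)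
    rcases le_or_gt s 0 with hs | hs
    · simp [posPow_of_nonpos hs]
    · simp [posPow_of_nonpos (by linarith : t - m - s ≤ 0)]

lemma integral_posPow_mul_posPow_pos {γ δ : ℝ} (hγ : -1 < γ) (hδ : 0 ≤ δ) :
    0 < ∫ s, posPow γ (1 - s) * posPow δ s := by
  have hint := integrable_posPow_mul_posPow hγ hδ 1 0
  simp only [sub_zero] at hint
  rw [integral_pos_iff_support_of_nonneg
    (fun s => mul_nonneg (posPow_nonneg _ _) (posPow_nonneg _ _)) hint]
  refine lt_of_lt_of_le ?_ (measure_mono (s := Set.Ioo (0 : ℝ) 1) fun s hs => ?_)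
  · simp
  · have h1 : 0 < 1 - s := by linarith [hs.2]
    have h0 : 0 < s := hs.1
    rw [Function.mem_support, posPow_of_pos h1, posPow_of_pos h0]
    positivity

lemma hasDerivAt_fwdDiff_iter {f f' : ℝ → ℝ} (hf : ∀ x, 0 < x → HasDerivAt f (f' x) x)
    {h : ℝ} (hh : 0 ≤ h) (j : ℕ) {x : ℝ} (hx : 0 < x) :
    HasDerivAt ((fwdDiff h)^[j] f) ((fwdDiff h)^[j] f' x) x := by
  induction j generalizing x with
  | zero => exact hf x hx
  | succ j ih =>
    rw [Function.iterate_succ_apply', Function.iterate_succ_apply']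
    exact (HasDerivAt.comp_add_const x h (ih (by positivity : 0 < x + h))).sub (ih hx)

/-- Each forward difference improves the decay of a negative power by one order. -/
lemma exists_abs_fwdDiff_iter_rpow_le {h : ℝ} (hh : 0 ≤ h) (j : ℕ) {γ : ℝ} (hγ : γ ≤ 0) :
    ∃ C, 0 ≤ C ∧ ∀ x : ℝ, 0 < x →
      |(fwdDiff h)^[j] (fun t : ℝ => t ^ γ) x| ≤ C * x ^ (γ - j) := by
  induction j generalizing γ with
  | zero =>
    refine ⟨1, zero_le_one, fun x hx => ?_⟩
    simp [abs_of_nonneg (Real.rpow_nonneg hx.le _)]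
  | succ j ih =>
    obtain ⟨C, hC0, hC⟩ := ih (by linarith : γ - 1 ≤ 0)
    refine ⟨|γ| * C * h, by positivity, fun x hx => ?_⟩
    have hd : ∀ y, 0 < y → HasDerivAt ((fwdDiff h)^[j] (fun t : ℝ => t ^ γ))
        (γ * (fwdDiff h)^[j] (fun t : ℝ => t ^ (γ - 1)) y) y := by
      intro y hy
      have := hasDerivAt_fwdDiff_iter (f := fun t : ℝ => t ^ γ)
        (f' := γ • fun t : ℝ => t ^ (γ - 1))
        (fun z hz => by simpa using Real.hasDerivAt_rpow_const (p := γ) (Or.inl hz.ne')) hh j hy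
      rwa [fwdDiff_iter_const_smul] at this
    have hb : ∀ y ∈ Set.Icc x (x + h),
        ‖γ * (fwdDiff h)^[j] (fun t : ℝ => t ^ (γ - 1)) y‖ ≤ |γ| * (C * x ^ (γ - 1 - j)) := by
      intro y hy
      have hy0 : 0 < y := hx.trans_le hy.1
      rw [norm_mul, Real.norm_eq_abs, Real.norm_eq_abs]
      have h2 : y ^ (γ - 1 - j) ≤ x ^ (γ - 1 - j) :=
        Real.rpow_le_rpow_of_nonpos hx hy.1 (by
          have : (0 : ℝ) ≤ j := j.cast_nonneg
          linarith)
      gcongr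
      exact (hC y hy0).trans (by gcongr)
    have := (convex_Icc x (x + h)).norm_image_sub_le_of_norm_hasDerivWithin_le
      (fun y hy => (hd y (hx.trans_le hy.1)).hasDerivWithinAt) hb
      (Set.left_mem_Icc.2 (by linarith)) (Set.right_mem_Icc.2 (by linarith))
    rw [Function.iterate_succ_apply', fwdDiff, ← Real.norm_eq_abs]
    refine this.trans (le_of_eq ?_)
    rw [add_sub_cancel_left, Real.norm_of_nonneg hh, show γ - ((j + 1 : ℕ) : ℝ) = γ - 1 - j by
      push_cast; ring]
    ring

/-- A forward difference of high order of a truncated power is integrable over the whole line. -/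
lemma integrable_fwdDiff_iter_posPow {h : ℝ} (hh : 0 ≤ h) {j : ℕ} {γ : ℝ} (hγ : -1 < γ)
    (hγ0 : γ ≤ 0) (hj : γ - j < -1) : Integrable ((fwdDiff h)^[j] (posPow γ)) := by
  have hsum : (fwdDiff h)^[j] (posPow γ) = fun y => ∑ i ∈ Finset.range (j + 1),
      (((-1 : ℤ) ^ (j - i) * j.choose i : ℤ) : ℝ) * posPow γ (y + i • h) := by
    ext y
    rw [fwdDiff_iter_eq_sum_shift]
    exact Finset.sum_congr rfl fun i _ => zsmul_eq_mul _ _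
  have hmeas : Measurable ((fwdDiff h)^[j] (posPow γ)) := by
    rw [hsum]
    refine Finset.measurable_sum _ fun i _ => Measurable.const_mul ?_ _
    exact (measurable_posPow γ).comp (measurable_id.add_const _)
  have hloc : ∀ a b, IntervalIntegrable ((fwdDiff h)^[j] (posPow γ)) volume a b := by
    intro a b
    rw [hsum]
    simp only [← Finset.sum_fn]
    refine IntervalIntegrable.sum _ fun i _ => IntervalIntegrable.const_mul ?_ _
    have h1 := (intervalIntegrable_posPow hγ (a + i • h) (b + i • h)).comp_add_right (i • h)
    simpa using h1
  obtain ⟨C, hC0, hC⟩ := exists_abs_fwdDiff_iter_rpow_le hh j hγ0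
  have hright : IntegrableOn ((fwdDiff h)^[j] (posPow γ)) (Set.Ioi 1) := by
    have h1 : IntegrableOn (fun x : ℝ => C * x ^ (γ - j)) (Set.Ioi 1) :=
      (integrableOn_Ioi_rpow_of_lt hj one_pos).const_mul C
    refine Integrable.mono' h1 hmeas.aestronglyMeasurable ?_
    filter_upwards [ae_restrict_mem measurableSet_Ioi] with x hx
    have hx0 : (0 : ℝ) < x := one_pos.trans hx
    refine le_trans (le_of_eq ?_) (hC x hx0)
    rw [Real.norm_eq_abs, fwdDiff_iter_eq_sum_shift, fwdDiff_iter_eq_sum_shift]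
    congr 1
    refine Finset.sum_congr rfl fun i _ => ?_
    rw [posPow_of_pos (by positivity)]
  have hleft : IntegrableOn ((fwdDiff h)^[j] (posPow γ)) (Set.Iic (-(j * h))) := by
    refine (integrableOn_zero (ε' := ℝ)).congr_fun (fun x hx => ?_) measurableSet_Iic
    rw [hsum]
    refine (Finset.sum_eq_zero fun i hi => ?_).symm
    have hi' : (i : ℝ) ≤ j := by exact_mod_cast Nat.lt_succ_iff.1 (Finset.mem_range.1 hi)
    rw [Set.mem_Iic] at hx
    rw [posPow_of_nonpos (by rw [nsmul_eq_mul]; nlinarith), mul_zero]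
  have hmid : IntegrableOn ((fwdDiff h)^[j] (posPow γ)) (Set.Ioc (-(j * h)) 1) := by
    have h0 : -(j * h) ≤ 1 := by
      have : 0 ≤ j * h := by positivity
      linarith
    exact (intervalIntegrable_iff_integrableOn_Ioc_of_le h0).1 (hloc _ _)
  have huniv : Set.Iic (-(j * h)) ∪ Set.Ioc (-(j * h)) 1 ∪ Set.Ioi 1 = Set.univ := by
    ext x
    simp only [Set.mem_union, Set.mem_Iic, Set.mem_Ioc, Set.mem_Ioi, Set.mem_univ, iff_true]
    rcases le_or_gt x (-(j * h)) with h1 | h1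
    · exact Or.inl (Or.inl h1)
    · rcases le_or_gt x 1 with h2 | h2
      · exact Or.inl (Or.inr ⟨h1, h2⟩)
      · exact Or.inr h2
  rw [← integrableOn_univ, ← huniv]
  exact (hleft.union hmid).union hright

lemma fwdDiff_iter_sub_pow_eq_zero (h m y : ℝ) (k : ℕ) :
    (fwdDiff h)^[k + 1] (fun t : ℝ => (t - m) ^ k) y = 0 := by
  set P : Polynomial ℝ :=
    (Polynomial.C (y - m) + Polynomial.C h * Polynomial.X) ^ k with hP
  have hdeg : P.natDegree < k + 1 := by
    refine Nat.lt_succ_of_le ((Polynomial.natDegree_pow_le).trans ?_)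
    have : (Polynomial.C (y - m) + Polynomial.C h * Polynomial.X).natDegree ≤ 1 := by
      compute_degree
    nlinarith
  have h1 := congrFun (Polynomial.fwdDiff_iter_eq_zero_of_degree_lt hdeg) 0
  rw [fwdDiff_iter_eq_sum_shift] at h1 ⊢
  rw [Pi.zero_apply] at h1
  rw [← h1]
  refine Finset.sum_congr rfl fun i _ => ?_
  congr 1
  simp only [hP, Polynomial.eval_pow, Polynomial.eval_add, Polynomial.eval_mul,
    Polynomial.eval_C, Polynomial.eval_X, nsmul_eq_mul]
  ring

/-- The Riesz sum `∑_{n < s} (s - n) ^ δ u n = s ^ δ S_s` as a combination of truncated powers. -/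
lemma sum_mul_posPow_eq_rieszMean (δ : ℝ) (u : ℕ → ℝ) {N : ℕ} {s : ℝ} (hs : 0 < s)
    (hsN : s ≤ N + 1) :
    ∑ n ∈ Finset.range (N + 1), u n * posPow δ (s - n) = s ^ δ * rieszMean δ u s := by
  rw [rieszMean, Finset.mul_sum]
  symm
  have hsub : Finset.range ⌈s⌉₊ ⊆ Finset.range (N + 1) :=
    Finset.range_mono (Nat.ceil_le.2 (by exact_mod_cast hsN))
  refine (Finset.sum_congr rfl fun n hn => ?_).trans
    (Finset.sum_subset hsub fun n _ hn => ?_)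
  · have hn' : (n : ℝ) < s := Nat.lt_ceil.1 (Finset.mem_range.1 hn)
    have h1 : s - n = s * (1 - n / s) := by field_simp
    have h2 : 0 < 1 - n / s := by
      rw [sub_pos, div_lt_one hs]; exact hn'
    rw [posPow_of_pos (by linarith), h1, Real.mul_rpow hs.le h2.le]
    ring
  · have hn' : s ≤ n := not_lt.1 fun h => hn (Finset.mem_range.2 (Nat.lt_ceil.2 h))
    rw [posPow_of_nonpos (by linarith), mul_zero]

lemma exists_abs_rieszMean_le {δ : ℝ} (hδ : 0 ≤ δ) {u : ℕ → ℝ} {l : ℝ}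
    (h : Tendsto (rieszMean δ u) atTop (𝓝 l)) : ∃ B, ∀ r, 0 < r → |rieszMean δ u r| ≤ B := by
  obtain ⟨r₀, hr₀⟩ := eventually_atTop.1 (h.abs.eventually_le_const (lt_add_one |l|))
  refine ⟨max (|l| + 1) (∑ n ∈ Finset.range ⌈r₀⌉₊, |u n|), fun r hr => ?_⟩
  rcases le_total r₀ r with hle | hle
  · exact (hr₀ r hle).trans (le_max_left _ _)
  · refine le_trans ?_ (le_max_right _ _)
    refine (Finset.abs_sum_le_sum_abs _ _).trans ?_
    refine le_trans (Finset.sum_le_sum fun n hn => ?_)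
      (Finset.sum_le_sum_of_subset_of_nonneg (Finset.range_mono (Nat.ceil_mono hle))
        fun _ _ _ => abs_nonneg _)
    have hn' : (n : ℝ) < r := Nat.lt_ceil.1 (Finset.mem_range.1 hn)
    have h2 : 0 ≤ 1 - (n : ℝ) / r := by
      rw [sub_nonneg, div_le_one hr]; exact hn'.le
    have h3 : 1 - (n : ℝ) / r ≤ 1 := by
      have : (0 : ℝ) ≤ n / r := by positivity
      linarith
    rw [abs_mul, abs_of_nonneg (Real.rpow_nonneg h2 _)]
    exact mul_le_of_le_one_left (abs_nonneg _) (Real.rpow_le_one h2 h3 hδ)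

/-- The terms of a series with bounded Riesz means of order `δ` are `O(n ^ δ)`. Fractional
integration turns the Riesz sums of order `δ` into those of an integer order `k > δ`; as a function
of the parameter `r` these are piecewise polynomial of degree `k`, so that a difference of order
`k + 1` taken with a small step near `N` isolates the term `u N`. -/
lemma exists_abs_le_of_abs_rieszMean_le {δ : ℝ} (hδ : 0 ≤ δ) {u : ℕ → ℝ} {B : ℝ}
    (hB : ∀ r, 0 < r → |rieszMean δ u r| ≤ B) :
    ∃ M, ∀ n : ℕ, |u n| ≤ M * ((n : ℝ) + 1) ^ δ := by
  set k : ℕ := ⌊δ⌋₊ + 1 with hk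
  have hk1 : δ < k := by rw [hk]; push_cast; exact Nat.lt_floor_add_one δ
  have hk2 : (k : ℝ) ≤ δ + 1 := by
    rw [hk]; push_cast; linarith [Nat.floor_le hδ]
  set γ : ℝ := k - δ - 1 with hγdef
  have hγ : -1 < γ := by linarith
  have hγ0 : γ ≤ 0 := by linarith
  set h : ℝ := 1 / ((k : ℝ) + 1) with hh
  have hh0 : 0 < h := by positivity
  have hkh : (k + 1 : ℝ) * h = 1 := by rw [hh]; field_simp
  set c : ℝ := ∫ s, posPow γ (1 - s) * posPow δ s with hc
  have hc0 : 0 < c := integral_posPow_mul_posPow_pos hγ hδ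
  set D : ℝ → ℝ := (fwdDiff h)^[k + 1] (posPow γ) with hD
  have hDint : Integrable D := integrable_fwdDiff_iter_posPow hh0.le hγ hγ0 (by
    push_cast; linarith)
  have hB0 : 0 ≤ B := (abs_nonneg _).trans (hB 1 one_pos)
  refine ⟨(B * ∫ y, |D y|) / (c * h ^ k), fun N => ?_⟩
  set T : ℝ → ℝ := fun s => ∑ n ∈ Finset.range (N + 1), u n * posPow δ (s - n) with hT
  -- The sample points `y₀ + i h`, `i ≤ k + 1`, lie in `(N - 1, N + 1]`.
  set y₀ : ℝ := N - k * h with hy₀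
  have hconv : ∀ t n : ℝ, ∫ s, posPow γ (t - s) * posPow δ (s - n) = c * posPow k (t - n) := by
    intro t n
    rw [integral_posPow_mul_posPow, show γ + δ + 1 = k by rw [hγdef]; ring]
  have hTint : ∀ t, Integrable fun s => posPow γ (t - s) * T s := by
    intro t
    simp only [hT, Finset.mul_sum]
    refine integrable_finsetSum _ fun n _ => ?_
    refine ((integrable_posPow_mul_posPow hγ hδ t n).const_mul (u n)).congr
      (ae_of_all _ fun s => ?_)
    ring
  have hF : ∀ t, ∫ s, posPow γ (t - s) * T s
      = ∑ n ∈ Finset.range (N + 1), (c * u n) * posPow k (t - n) := by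
    intro t
    simp only [hT, Finset.mul_sum]
    rw [integral_finsetSum]
    · refine Finset.sum_congr rfl fun n _ => ?_
      rw [mul_right_comm, ← hconv, mul_comm _ (u n), ← integral_const_mul]
      congr 1 with s
      ring
    · intro n _
      refine ((integrable_posPow_mul_posPow hγ hδ t n).const_mul (u n)).congr
        (ae_of_all _ fun s => ?_)
      ring
  have hpt : ∀ i ∈ Finset.range (k + 1 + 1), y₀ + i • h ≤ N ∨ i = k + 1 := by
    intro i hi
    rcases (Nat.lt_succ_iff.1 (Finset.mem_range.1 hi)).eq_or_lt with h1 | h1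
    · exact Or.inr h1
    · left
      have : (i : ℝ) ≤ k := by exact_mod_cast Nat.lt_succ_iff.1 h1
      rw [hy₀, nsmul_eq_mul]
      nlinarith
  -- Near `N` the terms with `n < N` are polynomials of degree `k` in `t`, which the difference
  -- annihilates; the term with `n = N` vanishes at all sample points but the last, `N + h`.
  have hdiff : (fwdDiff h)^[k + 1] (fun t => ∫ s, posPow γ (t - s) * T s) y₀
      = c * u N * h ^ k := by
    have h1 : (fun t => ∫ s, posPow γ (t - s) * T s)
        = ∑ n ∈ Finset.range (N + 1), (c * u n) • fun t => posPow k (t - n) := by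
      ext t
      rw [hF, Finset.sum_apply]
      rfl
    rw [h1, fwdDiff_iter_finsetSum, Finset.sum_apply, Finset.sum_range_succ,
      Finset.sum_eq_zero, zero_add]
    · rw [fwdDiff_iter_const_smul, Pi.smul_apply, smul_eq_mul, fwdDiff_iter_eq_sum_shift,
        Finset.sum_range_succ, Finset.sum_eq_zero, zero_add]
      · have h2 : y₀ + (k + 1) • h - N = h := by
          rw [hy₀, nsmul_eq_mul]; push_cast; ring
        rw [h2, posPow_of_pos hh0]
        simp
      · intro i hi
        have hi' := Finset.mem_range.1 hi
        rcases hpt i (Finset.mem_range.2 (by omega)) with h2 | h2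
        · rw [posPow_of_nonpos (by linarith), smul_zero]
        · omega
    · intro n hn
      have hn' : (n : ℝ) + 1 ≤ N := by exact_mod_cast Finset.mem_range.1 hn
      rw [fwdDiff_iter_const_smul, Pi.smul_apply]
      have h2 : (fwdDiff h)^[k + 1] (fun t => posPow k (t - n)) y₀
          = (fwdDiff h)^[k + 1] (fun t : ℝ => (t - n) ^ k) y₀ := by
        rw [fwdDiff_iter_eq_sum_shift, fwdDiff_iter_eq_sum_shift]
        refine Finset.sum_congr rfl fun i _ => ?_
        have h3 : 0 < y₀ + i • h - n := by
          have : (0 : ℝ) ≤ i • h := by positivity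
          nlinarith
        rw [posPow_of_pos h3, Real.rpow_natCast]
      rw [h2, fwdDiff_iter_sub_pow_eq_zero, smul_zero]
  -- Taking the difference under the integral sign puts it on the kernel.
  have hkernel : (fwdDiff h)^[k + 1] (fun t => ∫ s, posPow γ (t - s) * T s) y₀
      = ∫ s, D (y₀ - s) * T s := by
    rw [fwdDiff_iter_eq_sum_shift]
    simp only [hD, fwdDiff_iter_eq_sum_shift, Finset.sum_mul]
    rw [integral_finsetSum]
    · refine Finset.sum_congr rfl fun i _ => ?_
      rw [zsmul_eq_mul, ← integral_const_mul]
      congr 1 with s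
      rw [zsmul_eq_mul, mul_assoc, add_sub_right_comm y₀]
    · intro i _
      refine ((hTint (y₀ + i • h)).const_mul
        ((((-1 : ℤ) ^ (k + 1 - i) * (k + 1).choose i : ℤ) : ℝ))).congr (ae_of_all _ fun s => ?_)
      simp only [zsmul_eq_mul]
      rw [mul_assoc, add_sub_right_comm y₀]
  have hbound : ∀ s, ‖D (y₀ - s) * T s‖ ≤ |D (y₀ - s)| * (B * ((N : ℝ) + 1) ^ δ) := by
    intro s
    rw [norm_mul, Real.norm_eq_abs, Real.norm_eq_abs]
    rcases le_or_gt s 0 with hs | hs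
    · have : T s = 0 := Finset.sum_eq_zero fun n _ => by
        rw [posPow_of_nonpos (by linarith [(n.cast_nonneg : (0 : ℝ) ≤ n)]), mul_zero]
      rw [this, abs_zero, mul_zero]
      positivity
    rcases le_or_gt s (N + 1) with hs1 | hs1
    · refine mul_le_mul_of_nonneg_left ?_ (abs_nonneg _)
      rw [hT]
      simp only
      rw [sum_mul_posPow_eq_rieszMean δ u hs hs1, abs_mul, abs_of_nonneg (by positivity), mul_comm]
      exact mul_le_mul (hB s hs) (Real.rpow_le_rpow hs.le hs1 hδ) (by positivity) hB0
    · have : D (y₀ - s) = 0 := by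
        rw [hD, fwdDiff_iter_eq_sum_shift]
        refine Finset.sum_eq_zero fun i hi => ?_
        have hi' : (i : ℝ) ≤ k + 1 := by
          exact_mod_cast Nat.lt_succ_iff.1 (Finset.mem_range.1 hi)
        rw [posPow_of_nonpos, smul_zero]
        rw [hy₀, nsmul_eq_mul]
        nlinarith [(k.cast_nonneg : (0 : ℝ) ≤ k)]
      rw [this, abs_zero, zero_mul, zero_mul]
  have hfin : |c * u N * h ^ k| ≤ (∫ y, |D y|) * (B * ((N : ℝ) + 1) ^ δ) := by
    rw [← hdiff, hkernel, ← Real.norm_eq_abs]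
    refine (norm_integral_le_of_norm_le ?_ (ae_of_all _ hbound)).trans (le_of_eq ?_)
    · exact (hDint.comp_sub_left y₀).abs.mul_const _
    · rw [integral_mul_const, integral_sub_left_eq_self (fun y => |D y|)]
  rw [abs_mul, abs_mul, abs_of_pos hc0, abs_of_pos (pow_pos hh0 k)] at hfin
  rw [div_mul_eq_mul_div, le_div_iff₀ (by positivity)]
  linarith

lemma exists_abs_le_of_tendsto_rieszMean {δ : ℝ} (hδ : 0 ≤ δ) {u : ℕ → ℝ} {l : ℝ}
    (h : Tendsto (rieszMean δ u) atTop (𝓝 l)) :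
    ∃ M, ∀ n : ℕ, |u n| ≤ M * ((n : ℝ) + 1) ^ δ := by
  obtain ⟨B, hB⟩ := exists_abs_rieszMean_le hδ h
  exact exists_abs_le_of_abs_rieszMean_le hδ hB

/-! ### The hypergeometric equation for Jacobi polynomials -/

/-- The polynomial `q` solves the hypergeometric equation
`t (1 - t) q'' + (c - (s + 1) t) q' + l q = 0`. The Jacobi polynomial `P_n` in the variable
`t = (1 - x) / 2` solves it for `c = α + 1`, `s = α + β + 1` and `l = n (n + s)`. -/
def IsHypergeometric (c s l : ℝ) (q : Polynomial ℝ) : Prop :=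
  Polynomial.X * (1 - Polynomial.X) * q.derivative.derivative +
    (Polynomial.C c - Polynomial.C (s + 1) * Polynomial.X) * q.derivative +
    Polynomial.C l * q = 0

lemma isHypergeometric_iff_coeff {c s l : ℝ} {q : Polynomial ℝ} :
    IsHypergeometric c s l q ↔
      ∀ k : ℕ, ((k : ℝ) + 1) * (k + c) * q.coeff (k + 1) = (k * (k + s) - l) * q.coeff k := by
  have hcoeff : ∀ k : ℕ, (Polynomial.X * (1 - Polynomial.X) * q.derivative.derivative +
      (Polynomial.C c - Polynomial.C (s + 1) * Polynomial.X) * q.derivative +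
      Polynomial.C l * q).coeff k
      = ((k : ℝ) + 1) * (k + c) * q.coeff (k + 1) - (k * (k + s) - l) * q.coeff k := by
    intro k
    have e : Polynomial.X * (1 - Polynomial.X) * q.derivative.derivative +
      (Polynomial.C c - Polynomial.C (s + 1) * Polynomial.X) * q.derivative +
      Polynomial.C l * q = Polynomial.X * q.derivative.derivative
        - Polynomial.X * (Polynomial.X * q.derivative.derivative)
        + Polynomial.C c * q.derivative - Polynomial.C (s + 1) * (Polynomial.X * q.derivative)
        + Polynomial.C l * q := by ring
    rw [e]
    rcases k with _ | _ | k
    · simp [Polynomial.coeff_derivative]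
    · simp only [Polynomial.coeff_add, Polynomial.coeff_sub, Polynomial.coeff_C_mul,
        Polynomial.coeff_X_mul, Polynomial.coeff_X_mul_zero, Polynomial.coeff_derivative]
      push_cast
      ring
    · simp only [Polynomial.coeff_add, Polynomial.coeff_sub, Polynomial.coeff_C_mul,
        Polynomial.coeff_X_mul, Polynomial.coeff_derivative]
      push_cast
      ring
  rw [IsHypergeometric, Polynomial.ext_iff]
  refine forall_congr' fun k => ?_
  rw [hcoeff k, Polynomial.coeff_zero, sub_eq_zero]

lemma IsHypergeometric.eval {c s l : ℝ} {q : Polynomial ℝ} (h : IsHypergeometric c s l q)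
    (t : ℝ) : t * (1 - t) * q.derivative.derivative.eval t
      + (c - (s + 1) * t) * q.derivative.eval t + l * q.eval t = 0 := by
  have := congrArg (Polynomial.eval t) h
  simpa using this

/-- The reflection `t ↦ 1 - t` exchanges the two singular points of the equation. -/
lemma IsHypergeometric.comp_one_sub {c s l : ℝ} {q : Polynomial ℝ}
    (h : IsHypergeometric c s l q) :
    IsHypergeometric (s + 1 - c) s l (q.comp (1 - Polynomial.X)) := by
  have h1 := congrArg (fun r => Polynomial.comp r (1 - Polynomial.X)) h
  have d : ∀ r : Polynomial ℝ, (r.comp (1 - Polynomial.X)).derivative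
      = - r.derivative.comp (1 - Polynomial.X) := by
    intro r
    rw [Polynomial.derivative_comp]
    simp
  rw [IsHypergeometric, d, Polynomial.derivative_neg, d]
  simp only [Polynomial.add_comp, Polynomial.mul_comp, Polynomial.sub_comp, Polynomial.one_comp,
    Polynomial.X_comp, Polynomial.C_comp, Polynomial.zero_comp] at h1
  rw [← h1]
  simp only [map_sub, map_add, map_one]
  ring

section Bounds

variable {c s : ℝ} {n : ℕ} {q : Polynomial ℝ}

lemma IsHypergeometric.coeff_succ_le (h : IsHypergeometric c s (n * (n + s)) q)
    (hc : 1 / 2 ≤ c) (hs : 0 ≤ s) (k : ℕ) :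
    ((k : ℝ) + 1) * |q.coeff (k + 1)| ≤ 2 * (n * (n + s)) * |q.coeff k| := by
  have hrec := isHypergeometric_iff_coeff.1 h
  have hzero : ∀ m : ℕ, q.coeff (n + 1 + m) = 0 := by
    intro m
    have hpos : ∀ i : ℕ, (0 : ℝ) < ((i : ℝ) + 1) * (i + c) := fun i => by positivity
    induction m with
    | zero =>
      have := hrec n
      rw [sub_self, zero_mul] at this
      exact (mul_eq_zero.1 this).resolve_left (hpos n).ne'
    | succ m ih =>
      have := hrec (n + 1 + m)
      rw [ih, mul_zero] at this
      exact (mul_eq_zero.1 this).resolve_left (hpos _).ne'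
  rcases le_or_gt k n with hk | hk
  · have hk' : (k : ℝ) ≤ n := by exact_mod_cast hk
    have hk0 : (0 : ℝ) ≤ k := k.cast_nonneg
    have h1 := congrArg abs (hrec k)
    rw [abs_mul, abs_mul _ (q.coeff k), abs_of_nonneg (by positivity : 0 ≤ ((k : ℝ) + 1) * (k + c)),
      abs_of_nonpos (by nlinarith : (k : ℝ) * (k + s) - n * (n + s) ≤ 0)] at h1
    have h2 : 0 ≤ ((k : ℝ) + 1) * |q.coeff (k + 1)| := by positivity
    have h3 : ((k : ℝ) + 1) * |q.coeff (k + 1)| * (1 / 2)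
        ≤ ((k : ℝ) + 1) * |q.coeff (k + 1)| * (k + c) :=
      mul_le_mul_of_nonneg_left (by linarith) h2
    have h4 : (-(k * (k + s) - n * (n + s))) * |q.coeff k| ≤ (n * (n + s)) * |q.coeff k| :=
      mul_le_mul_of_nonneg_right (by nlinarith) (abs_nonneg _)
    nlinarith
  · obtain ⟨m, rfl⟩ := Nat.exists_eq_add_of_lt hk
    have := hzero (m + 1)
    rw [show n + m + 1 + 1 = n + 1 + (m + 1) by ring, this, abs_zero, mul_zero]
    positivity

lemma IsHypergeometric.coeff_le (h : IsHypergeometric c s (n * (n + s)) q)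
    (hc : 1 / 2 ≤ c) (hs : 0 ≤ s) (k : ℕ) :
    |q.coeff k| ≤ (2 * (n * (n + s))) ^ k * |q.coeff 0| := by
  induction k with
  | zero => simp
  | succ k ih =>
    have h1 := h.coeff_succ_le hc hs k
    have h2 : |q.coeff (k + 1)| ≤ ((k : ℝ) + 1) * |q.coeff (k + 1)| :=
      le_mul_of_one_le_left (abs_nonneg _) (by linarith [(k.cast_nonneg : (0 : ℝ) ≤ k)])
    calc |q.coeff (k + 1)| ≤ 2 * (n * (n + s)) * |q.coeff k| := h2.trans h1
      _ ≤ 2 * (n * (n + s)) * ((2 * (n * (n + s))) ^ k * |q.coeff 0|) := by gcongr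
      _ = _ := by ring

lemma sum_one_third_pow_le (m : ℕ) : ∑ k ∈ Finset.range m, (1 / 3 : ℝ) ^ k ≤ 3 / 2 := by
  have h : (0 : ℝ) ≤ (1 / 3) ^ m := by positivity
  rw [geom_sum_eq (by norm_num), div_le_iff_of_neg (by norm_num)]
  linarith

/-- Near its singular point a polynomial solution is comparable to its value there. -/
lemma IsHypergeometric.abs_eval_sub_le (h : IsHypergeometric c s (n * (n + s)) q)
    (hc : 1 / 2 ≤ c) (hs : 0 ≤ s) {t : ℝ} (ht : 0 ≤ t) (ht' : 2 * (n * (n + s)) * t ≤ 1 / 3) :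
    |q.eval t - q.coeff 0| ≤ |q.coeff 0| / 2 := by
  rw [Polynomial.eval_eq_sum_range, Finset.sum_range_succ']
  simp only [pow_zero, mul_one, add_sub_cancel_right]
  have h1 : ∀ k ∈ Finset.range q.natDegree, |q.coeff (k + 1) * t ^ (k + 1)|
      ≤ |q.coeff 0| * (1 / 3) * (1 / 3) ^ k := by
    intro k _
    rw [abs_mul, abs_pow, abs_of_nonneg ht]
    calc |q.coeff (k + 1)| * t ^ (k + 1)
        ≤ (2 * (n * (n + s))) ^ (k + 1) * |q.coeff 0| * t ^ (k + 1) := by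
          gcongr
          exact h.coeff_le hc hs _
      _ = |q.coeff 0| * (2 * (n * (n + s)) * t) ^ (k + 1) := by rw [mul_pow _ t]; ring
      _ ≤ |q.coeff 0| * (1 / 3) ^ (k + 1) := by gcongr
      _ = _ := by ring
  refine (Finset.abs_sum_le_sum_abs _ _).trans ((Finset.sum_le_sum h1).trans ?_)
  rw [← Finset.mul_sum]
  have := sum_one_third_pow_le q.natDegree
  nlinarith [abs_nonneg (q.coeff 0)]

lemma IsHypergeometric.abs_eval_derivative_le (h : IsHypergeometric c s (n * (n + s)) q)
    (hc : 1 / 2 ≤ c) (hs : 0 ≤ s) {t : ℝ} (ht : 0 ≤ t) (ht' : 2 * (n * (n + s)) * t ≤ 1 / 3) :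
    |q.derivative.eval t| ≤ 3 * (n * (n + s)) * |q.coeff 0| := by
  rw [Polynomial.eval_eq_sum_range]
  have h1 : ∀ k ∈ Finset.range (q.derivative.natDegree + 1), |q.derivative.coeff k * t ^ k|
      ≤ 2 * (n * (n + s)) * |q.coeff 0| * (1 / 3) ^ k := by
    intro k _
    rw [Polynomial.coeff_derivative, abs_mul, abs_mul, abs_pow, abs_of_nonneg ht,
      abs_of_nonneg (by positivity : 0 ≤ (k : ℝ) + 1), mul_comm |_| ((k : ℝ) + 1)]
    calc ((k : ℝ) + 1) * |q.coeff (k + 1)| * t ^ k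
        ≤ 2 * (n * (n + s)) * |q.coeff k| * t ^ k := by
          exact mul_le_mul_of_nonneg_right (h.coeff_succ_le hc hs k) (by positivity)
      _ ≤ 2 * (n * (n + s)) * ((2 * (n * (n + s))) ^ k * |q.coeff 0|) * t ^ k := by
          gcongr
          exact h.coeff_le hc hs k
      _ = 2 * (n * (n + s)) * |q.coeff 0| * (2 * (n * (n + s)) * t) ^ k := by
          rw [mul_pow _ t]; ring
      _ ≤ _ := by gcongr
  refine (Finset.abs_sum_le_sum_abs _ _).trans ((Finset.sum_le_sum h1).trans ?_)
  rw [← Finset.mul_sum]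
  have := sum_one_third_pow_le (q.derivative.natDegree + 1)
  have h0 : 0 ≤ 2 * (n * (n + s)) * |q.coeff 0| := by positivity
  nlinarith

end Bounds

/-- The Jacobi polynomial in the variable `t = (1 - x) / 2`. -/
noncomputable def shiftedJacobi (α β : ℝ) (n : ℕ) : Polynomial ℝ :=
  (jacobiPoly α β n).comp (1 - Polynomial.C 2 * Polynomial.X)

lemma eval_shiftedJacobi (α β : ℝ) (n : ℕ) (t : ℝ) :
    (shiftedJacobi α β n).eval t = (jacobiPoly α β n).eval (1 - 2 * t) := by
  simp [shiftedJacobi]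

lemma coeff_shiftedJacobi (α β : ℝ) (n k : ℕ) :
    (shiftedJacobi α β n).coeff k = (-1) ^ k * ((n.choose k : ℝ) *
      (ascPochhammer ℝ k).eval ((n : ℝ) + α + β + 1) *
        (ascPochhammer ℝ (n - k)).eval (α + (k : ℝ) + 1) / (n.factorial : ℝ)) := by
  have h : shiftedJacobi α β n = ∑ k ∈ Finset.range (n + 1), Polynomial.C ((-1) ^ k *
      ((n.choose k : ℝ) * (ascPochhammer ℝ k).eval ((n : ℝ) + α + β + 1) *
        (ascPochhammer ℝ (n - k)).eval (α + (k : ℝ) + 1) / (n.factorial : ℝ))) *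
        Polynomial.X ^ k := by
    rw [shiftedJacobi, jacobiPoly, Polynomial.sum_comp]
    refine Finset.sum_congr rfl fun k _ => ?_
    simp only [Polynomial.mul_comp, Polynomial.C_comp, Polynomial.pow_comp, Polynomial.sub_comp,
      Polynomial.X_comp, Polynomial.one_comp]
    have h1 : Polynomial.C (1 / 2 : ℝ) * (1 - Polynomial.C 2 * Polynomial.X - 1)
        = -1 * Polynomial.X := by
      have : Polynomial.C (1 / 2 : ℝ) * Polynomial.C 2 = 1 := by
        rw [← Polynomial.C_mul]; norm_num
      linear_combination (-Polynomial.X) * this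
    rw [h1, mul_pow, Polynomial.C_mul, Polynomial.C_pow, Polynomial.C_neg, Polynomial.C_1]
    ring
  rw [h, Polynomial.finsetSum_coeff]
  simp only [Polynomial.coeff_C_mul_X_pow]
  rw [Finset.sum_ite_eq]
  split_ifs with hk
  · rfl
  · rw [Nat.choose_eq_zero_of_lt (by simpa using hk)]
    simp

lemma isHypergeometric_shiftedJacobi (α β : ℝ) (n : ℕ) :
    IsHypergeometric (α + 1) (α + β + 1) (n * (n + (α + β + 1))) (shiftedJacobi α β n) := by
  rw [isHypergeometric_iff_coeff]
  intro k
  rw [coeff_shiftedJacobi, coeff_shiftedJacobi]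
  rcases lt_or_ge k n with hk | hk
  · have h1 : ((n.choose (k + 1) : ℝ)) * (k + 1) = n.choose k * ((n : ℝ) - k) := by
      have := Nat.choose_succ_right_eq n k
      rw [← Nat.cast_sub hk.le]
      exact_mod_cast this
    have h2 := ascPochhammer_succ_eval (S := ℝ) k ((n : ℝ) + α + β + 1)
    have h3 : (ascPochhammer ℝ (n - k)).eval (α + (k : ℝ) + 1)
        = (α + k + 1) * (ascPochhammer ℝ (n - (k + 1))).eval (α + ((k + 1 : ℕ) : ℝ) + 1) := by
      obtain ⟨m, hm⟩ : ∃ m, n = k + 1 + m := ⟨n - (k + 1), by omega⟩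
      rw [show n - k = (n - (k + 1)) + 1 by omega, ascPochhammer_succ_left]
      simp only [Polynomial.eval_mul, Polynomial.eval_X, Polynomial.eval_comp,
        Polynomial.eval_add, Polynomial.eval_one]
      push_cast
      ring_nf
    rw [h2, h3, pow_succ]
    linear_combination (-(α + k + 1) * (n + α + β + 1 + k) * (-1) ^ k *
      (ascPochhammer ℝ k).eval ((n : ℝ) + α + β + 1) *
      (ascPochhammer ℝ (n - (k + 1))).eval (α + ((k + 1 : ℕ) : ℝ) + 1) / n.factorial) * h1
  · rw [Nat.choose_eq_zero_of_lt (by omega : n < k + 1)]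
    rcases hk.eq_or_lt with rfl | hk
    · push_cast
      ring
    · rw [Nat.choose_eq_zero_of_lt hk]
      simp

lemma coeff_zero_shiftedJacobi (α β : ℝ) (n : ℕ) :
    (shiftedJacobi α β n).coeff 0 = (jacobiPoly α β n).eval 1 := by
  rw [Polynomial.coeff_zero_eq_eval_zero, eval_shiftedJacobi, mul_zero, sub_zero]

lemma eval_one_jacobiPoly_pos {α : ℝ} (hα : -1 < α) (β : ℝ) (n : ℕ) :
    0 < (jacobiPoly α β n).eval 1 := by
  rw [← coeff_zero_shiftedJacobi, coeff_shiftedJacobi]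
  have h := ascPochhammer_pos n (α + 1) (by linarith)
  have hf : (0 : ℝ) < n.factorial := by exact_mod_cast n.factorial_pos
  simp only [pow_zero, Nat.choose_zero_right, Nat.cast_one, ascPochhammer_zero,
    Polynomial.eval_one, Nat.sub_zero, Nat.cast_zero, add_zero, one_mul]
  positivity

/-! ### Oscillations with an inverse square potential -/

/-- The function `u`, with derivative `v`, solves `u'' + (N ^ 2 + V) u = 0` on `(0, π)` for a
potential `V` that is at most `K / sin² θ`, that is, with at most inverse square singularities at
the end points. -/
structure IsOscillation (K N : ℝ) (u v V : ℝ → ℝ) : Prop where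
  hasDerivAt_fst : ∀ θ ∈ Set.Ioo 0 Real.pi, HasDerivAt u (v θ) θ
  hasDerivAt_snd : ∀ θ ∈ Set.Ioo 0 Real.pi, HasDerivAt v (-(N ^ 2 + V θ) * u θ) θ
  abs_potential_le : ∀ θ ∈ Set.Ioo 0 Real.pi, |V θ| ≤ K / Real.sin θ ^ 2

namespace IsOscillation

variable {K N : ℝ} {u v V : ℝ → ℝ}

lemma hasDerivAt_energy (h : IsOscillation K N u v V) {θ : ℝ} (hθ : θ ∈ Set.Ioo 0 Real.pi) :
    HasDerivAt (fun θ => v θ ^ 2 + N ^ 2 * u θ ^ 2) (-(2 * V θ * u θ * v θ)) θ := by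
  have h1 := h.hasDerivAt_fst θ hθ
  have h2 := h.hasDerivAt_snd θ hθ
  refine ((h2.pow 2).add ((h1.pow 2).const_mul (N ^ 2))).congr_deriv ?_
  ring

lemma abs_deriv_energy_le (h : IsOscillation K N u v V) (hN : 0 < N) {θ : ℝ}
    (hθ : θ ∈ Set.Ioo 0 Real.pi) :
    |-(2 * V θ * u θ * v θ)|
      ≤ K / N * (1 / Real.sin θ ^ 2) * (v θ ^ 2 + N ^ 2 * u θ ^ 2) := by
  have hV := h.abs_potential_le θ hθ
  have h1 : 2 * |u θ| * |v θ| ≤ (v θ ^ 2 + N ^ 2 * u θ ^ 2) / N := by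
    rw [le_div_iff₀ hN, ← sq_abs (u θ), ← sq_abs (v θ)]
    nlinarith [sq_nonneg (|v θ| - N * |u θ|)]
  calc |-(2 * V θ * u θ * v θ)| = |V θ| * (2 * |u θ| * |v θ|) := by
        rw [abs_neg, abs_mul, abs_mul, abs_mul, abs_two]; ring
    _ ≤ (K / Real.sin θ ^ 2) * ((v θ ^ 2 + N ^ 2 * u θ ^ 2) / N) :=
        mul_le_mul hV h1 (by positivity) ((abs_nonneg _).trans hV)
    _ = _ := by ring

lemma hasDerivAt_neg_cot {θ : ℝ} (hθ : θ ∈ Set.Ioo 0 Real.pi) (k : ℝ) :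
    HasDerivAt (fun θ => -(k * (Real.cos θ / Real.sin θ))) (k * (1 / Real.sin θ ^ 2)) θ := by
  have hs : Real.sin θ ≠ 0 := (Real.sin_pos_of_mem_Ioo hθ).ne'
  refine ((((Real.hasDerivAt_cos θ).div (Real.hasDerivAt_sin θ) hs).const_mul k).neg).congr_deriv ?_
  rw [← Real.sin_sq_add_cos_sq θ]
  ring

/-- The energy `v² + N² u²` at two points of `(0, π)` is comparable, with a constant that stays
bounded as long as the points keep a distance of order `1 / N` from the end points. The logarithmic
derivative of the energy is at most `K / (N sin² θ)`, the derivative of `-(K / N) cot θ`. -/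
lemma energy_le (h : IsOscillation K N u v V) (hN : 0 < N) (hK : 0 ≤ K) {L θ₁ θ₂ : ℝ}
    (h₁ : θ₁ ∈ Set.Ioo 0 Real.pi) (h₂ : θ₂ ∈ Set.Ioo 0 Real.pi)
    (hL₁ : |Real.cos θ₁ / Real.sin θ₁| ≤ L) (hL₂ : |Real.cos θ₂ / Real.sin θ₂| ≤ L) :
    v θ₂ ^ 2 + N ^ 2 * u θ₂ ^ 2
      ≤ Real.exp (2 * K * L / N) * (v θ₁ ^ 2 + N ^ 2 * u θ₁ ^ 2) := by
  set G : ℝ → ℝ := fun θ => v θ ^ 2 + N ^ 2 * u θ ^ 2 with hG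
  have hG0 : ∀ θ, 0 ≤ G θ := fun θ => by positivity
  set Φ : ℝ → ℝ := fun θ => -(K / N * (Real.cos θ / Real.sin θ)) with hΦ
  have hΦle : ∀ {x y : ℝ}, |Real.cos x / Real.sin x| ≤ L → |Real.cos y / Real.sin y| ≤ L →
      Φ x - Φ y ≤ 2 * K * L / N := by
    intro x y hx hy
    have h3 : Φ x - Φ y = K / N * (Real.cos y / Real.sin y - Real.cos x / Real.sin x) := by
      simp only [hΦ]; ring
    rw [h3, show 2 * K * L / N = K / N * (2 * L) by ring]
    refine mul_le_mul_of_nonneg_left ?_ (by positivity)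
    linarith [(abs_le.1 hx).1, (abs_le.1 hy).2]
  have hstep : ∀ σ θ, θ ∈ Set.Ioo 0 Real.pi → HasDerivAt (fun θ => G θ * Real.exp (σ * Φ θ))
      ((-(2 * V θ * u θ * v θ) + σ * (K / N * (1 / Real.sin θ ^ 2) * G θ))
        * Real.exp (σ * Φ θ)) θ := by
    intro σ θ hθ
    refine ((h.hasDerivAt_energy hθ).mul
      (((hasDerivAt_neg_cot hθ (K / N)).const_mul σ).exp)).congr_deriv ?_
    simp only [hG, hΦ]
    ring
  have hcont : ∀ σ, ContinuousOn (fun θ => G θ * Real.exp (σ * Φ θ)) (Set.Ioo 0 Real.pi) :=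
    fun σ θ hθ => (hstep σ θ hθ).continuousAt.continuousWithinAt
  rcases le_total θ₁ θ₂ with hle | hle
  · have hanti : AntitoneOn (fun θ => G θ * Real.exp (-1 * Φ θ)) (Set.Ioo 0 Real.pi) := by
      refine antitoneOn_of_deriv_nonpos (convex_Ioo _ _) (hcont (-1)) ?_ ?_
      · rw [interior_Ioo]
        exact fun θ hθ => (hstep (-1) θ hθ).differentiableAt.differentiableWithinAt
      · rw [interior_Ioo]
        intro θ hθ
        rw [(hstep (-1) θ hθ).deriv]
        refine mul_nonpos_of_nonpos_of_nonneg ?_ (Real.exp_pos _).le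
        linarith [(abs_le.1 (h.abs_deriv_energy_le hN hθ)).2]
    have h3 := hanti h₁ h₂ hle
    have h4 : G θ₂ ≤ G θ₁ * Real.exp (Φ θ₂ - Φ θ₁) := by
      have h5 := mul_le_mul_of_nonneg_right h3 (Real.exp_pos (Φ θ₂)).le
      simp only [mul_assoc, ← Real.exp_add] at h5
      rw [neg_one_mul, neg_add_cancel, Real.exp_zero, mul_one] at h5
      rwa [show Φ θ₂ - Φ θ₁ = -1 * Φ θ₁ + Φ θ₂ by ring]
    refine h4.trans ?_
    rw [mul_comm]
    exact mul_le_mul_of_nonneg_right (Real.exp_le_exp.2 (hΦle hL₂ hL₁)) (hG0 _)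
  · have hmono : MonotoneOn (fun θ => G θ * Real.exp (1 * Φ θ)) (Set.Ioo 0 Real.pi) := by
      refine monotoneOn_of_deriv_nonneg (convex_Ioo _ _) (hcont 1) ?_ ?_
      · rw [interior_Ioo]
        exact fun θ hθ => (hstep 1 θ hθ).differentiableAt.differentiableWithinAt
      · rw [interior_Ioo]
        intro θ hθ
        rw [(hstep 1 θ hθ).deriv]
        refine mul_nonneg ?_ (Real.exp_pos _).le
        linarith [(abs_le.1 (h.abs_deriv_energy_le hN hθ)).1]
    have h3 := hmono h₂ h₁ hle
    have h4 : G θ₂ ≤ G θ₁ * Real.exp (Φ θ₁ - Φ θ₂) := by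
      have h5 := mul_le_mul_of_nonneg_right h3 (Real.exp_pos (-Φ θ₂)).le
      simp only [mul_assoc, ← Real.exp_add] at h5
      rw [one_mul, add_neg_cancel, Real.exp_zero, mul_one] at h5
      rwa [show Φ θ₁ - Φ θ₂ = 1 * Φ θ₁ + -Φ θ₂ by ring]
    refine h4.trans ?_
    rw [mul_comm]
    exact mul_le_mul_of_nonneg_right (Real.exp_le_exp.2 (hΦle hL₁ hL₂)) (hG0 _)

end IsOscillation

lemma abs_cot_le_of_mem_Icc {ε θ : ℝ} (hε : 0 < ε) (hε' : ε < Real.pi / 2)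
    (hθ : θ ∈ Set.Icc ε (Real.pi - ε)) :
    θ ∈ Set.Ioo 0 Real.pi ∧ Real.sin ε ≤ Real.sin θ ∧
      |Real.cos θ / Real.sin θ| ≤ 1 / Real.sin ε := by
  have hmem : θ ∈ Set.Ioo 0 Real.pi := ⟨hε.trans_le hθ.1, by linarith [hθ.2]⟩
  have hsε : 0 < Real.sin ε := Real.sin_pos_of_pos_of_lt_pi hε (by linarith)
  have hle : Real.sin ε ≤ Real.sin θ := by
    rcases le_total θ (Real.pi / 2) with h | h
    · exact Real.sin_le_sin_of_le_of_le_pi_div_two (by linarith) h hθ.1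
    · rw [← Real.sin_pi_sub θ]
      exact Real.sin_le_sin_of_le_of_le_pi_div_two (by linarith) (by linarith)
        (by linarith [hθ.2])
  refine ⟨hmem, hle, ?_⟩
  rw [abs_div, abs_of_pos (hsε.trans_le hle)]
  exact div_le_div₀ zero_le_one (Real.abs_cos_le_one _) hsε hle

/-- Away from the end points a solution is, up to a relative error `O(1 / N)`, a pure oscillation
of frequency `N` (variation of constants). -/
lemma exists_abs_sub_pure_oscillation_le {K ε : ℝ} (hK : 0 ≤ K) (hε : 0 < ε)
    (hε' : ε < Real.pi / 2) :
    ∃ C, 0 ≤ C ∧ ∀ (N : ℝ) (u v V : ℝ → ℝ), 1 ≤ N → IsOscillation K N u v V →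
      ∃ A B : ℝ, N ^ 2 * (A ^ 2 + B ^ 2) = v (Real.pi / 2) ^ 2 + N ^ 2 * u (Real.pi / 2) ^ 2 ∧
        ∀ θ ∈ Set.Icc ε (Real.pi - ε), |u θ - (A * Real.cos (N * θ) + B * Real.sin (N * θ))|
          ≤ C / N * √(A ^ 2 + B ^ 2) := by
  set σ := Real.sin ε with hσ
  have hσ0 : 0 < σ := Real.sin_pos_of_pos_of_lt_pi hε (by linarith)
  set E := Real.exp (2 * K * (1 / σ)) with hE
  set C₀ := K / σ ^ 2 * √E with hC₀
  have hC₀0 : 0 ≤ C₀ := by positivity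
  refine ⟨2 * (C₀ * Real.pi), by positivity, fun N u v V hN h => ?_⟩
  have hN0 : 0 < N := by linarith
  -- `A` and `B` are the slowly varying coefficients of `cos (N θ)` and `sin (N θ)` in `u`.
  set A : ℝ → ℝ := fun θ => u θ * Real.cos (N * θ) - v θ / N * Real.sin (N * θ) with hA
  set B : ℝ → ℝ := fun θ => u θ * Real.sin (N * θ) + v θ / N * Real.cos (N * θ) with hB
  have hAB : ∀ θ, N ^ 2 * (A θ ^ 2 + B θ ^ 2) = v θ ^ 2 + N ^ 2 * u θ ^ 2 := by
    intro θ
    have h1 : A θ ^ 2 + B θ ^ 2 = (u θ ^ 2 + (v θ / N) ^ 2)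
        * (Real.sin (N * θ) ^ 2 + Real.cos (N * θ) ^ 2) := by
      simp only [hA, hB]; ring
    rw [h1, Real.sin_sq_add_cos_sq]
    field_simp
    ring
  have hu : ∀ θ, u θ = A θ * Real.cos (N * θ) + B θ * Real.sin (N * θ) := by
    intro θ
    have h1 : A θ * Real.cos (N * θ) + B θ * Real.sin (N * θ)
        = u θ * (Real.sin (N * θ) ^ 2 + Real.cos (N * θ) ^ 2) := by
      simp only [hA, hB]; ring
    rw [h1, Real.sin_sq_add_cos_sq, mul_one]
  set R := √(A (Real.pi / 2) ^ 2 + B (Real.pi / 2) ^ 2) with hR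
  have hmid : Real.pi / 2 ∈ Set.Icc ε (Real.pi - ε) := ⟨hε'.le, by linarith⟩
  refine ⟨A (Real.pi / 2), B (Real.pi / 2), hAB _, ?_⟩
  have hub : ∀ θ ∈ Set.Icc ε (Real.pi - ε), |u θ| ≤ √E * R := by
    intro θ hθ
    obtain ⟨h1, -, h2⟩ := abs_cot_le_of_mem_Icc hε hε' hθ
    obtain ⟨h3, -, h4⟩ := abs_cot_le_of_mem_Icc hε hε' hmid
    have h5 := h.energy_le hN0 hK h3 h1 h4 h2
    rw [← hAB, ← hAB] at h5
    rw [hR, ← Real.sqrt_mul (Real.exp_pos _).le]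
    refine Real.abs_le_sqrt ?_
    have h6 : Real.exp (2 * K * (1 / σ) / N) ≤ E :=
      Real.exp_le_exp.2 (div_le_self (by positivity) hN)
    have h7 : N ^ 2 * (A θ ^ 2 + B θ ^ 2)
        ≤ N ^ 2 * (E * (A (Real.pi / 2) ^ 2 + B (Real.pi / 2) ^ 2)) := by
      refine h5.trans ?_
      have : 0 ≤ N ^ 2 * (A (Real.pi / 2) ^ 2 + B (Real.pi / 2) ^ 2) := by positivity
      nlinarith
    refine le_trans ?_ (le_of_mul_le_mul_left h7 (by positivity))
    have h8 := hAB θ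
    have h9 : A θ ^ 2 + B θ ^ 2 = u θ ^ 2 + (v θ / N) ^ 2 := by
      field_simp
      linarith
    rw [h9]
    linarith [sq_nonneg (v θ / N)]
  have hVu : ∀ θ ∈ Set.Icc ε (Real.pi - ε), |V θ * u θ / N| ≤ C₀ / N * R := by
    intro θ hθ
    obtain ⟨h1, h2, -⟩ := abs_cot_le_of_mem_Icc hε hε' hθ
    have h3 : |V θ| ≤ K / σ ^ 2 := (h.abs_potential_le θ h1).trans (by gcongr)
    rw [abs_div, abs_mul, abs_of_pos hN0, hC₀]
    calc |V θ| * |u θ| / N ≤ K / σ ^ 2 * (√E * R) / N := by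
          gcongr
          exact hub θ hθ
      _ = _ := by ring
  have hdc : ∀ θ, HasDerivAt (fun θ => Real.cos (N * θ)) (-(N * Real.sin (N * θ))) θ := by
    intro θ
    refine (((hasDerivAt_id θ).const_mul N).cos).congr_deriv ?_
    simp only [id]; ring
  have hds : ∀ θ, HasDerivAt (fun θ => Real.sin (N * θ)) (N * Real.cos (N * θ)) θ := by
    intro θ
    refine (((hasDerivAt_id θ).const_mul N).sin).congr_deriv ?_
    simp only [id]; ring
  have hdA : ∀ θ ∈ Set.Icc ε (Real.pi - ε),
      HasDerivAt A (V θ * u θ / N * Real.sin (N * θ)) θ := by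
    intro θ hθ
    have h1 := (abs_cot_le_of_mem_Icc hε hε' hθ).1
    refine (((h.hasDerivAt_fst θ h1).mul (hdc θ)).sub
      (((h.hasDerivAt_snd θ h1).div_const N).mul (hds θ))).congr_deriv ?_
    field_simp
    ring
  have hdB : ∀ θ ∈ Set.Icc ε (Real.pi - ε),
      HasDerivAt B (-(V θ * u θ / N * Real.cos (N * θ))) θ := by
    intro θ hθ
    have h1 := (abs_cot_le_of_mem_Icc hε hε' hθ).1
    refine (((h.hasDerivAt_fst θ h1).mul (hds θ)).add
      (((h.hasDerivAt_snd θ h1).div_const N).mul (hdc θ))).congr_deriv ?_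
    field_simp
    ring
  intro θ hθ
  have hdist : |θ - Real.pi / 2| ≤ Real.pi := by
    rw [abs_le]; constructor <;> linarith [hθ.1, hθ.2, Real.pi_pos]
  have hlen : ∀ F F' : ℝ → ℝ, (∀ x ∈ Set.Icc ε (Real.pi - ε), HasDerivAt F (F' x) x) →
      (∀ x ∈ Set.Icc ε (Real.pi - ε), |F' x| ≤ C₀ / N * R) →
      |F θ - F (Real.pi / 2)| ≤ C₀ / N * R * Real.pi := by
    intro F F' hF hF'
    have := (convex_Icc ε (Real.pi - ε)).norm_image_sub_le_of_norm_hasDerivWithin_le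
      (fun x hx => (hF x hx).hasDerivWithinAt) hF' hmid hθ
    refine this.trans ?_
    rw [Real.norm_eq_abs]
    exact mul_le_mul_of_nonneg_left hdist (by positivity)
  have hA' := hlen A _ hdA fun x hx => by
    rw [abs_mul]
    exact (mul_le_of_le_one_right (abs_nonneg _) (Real.abs_sin_le_one _)).trans (hVu x hx)
  have hB' := hlen B _ hdB fun x hx => by
    rw [abs_neg, abs_mul]
    exact (mul_le_of_le_one_right (abs_nonneg _) (Real.abs_cos_le_one _)).trans (hVu x hx)
  rw [hu θ, show A θ * Real.cos (N * θ) + B θ * Real.sin (N * θ)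
    - (A (Real.pi / 2) * Real.cos (N * θ) + B (Real.pi / 2) * Real.sin (N * θ))
    = (A θ - A (Real.pi / 2)) * Real.cos (N * θ)
      + (B θ - B (Real.pi / 2)) * Real.sin (N * θ) by ring]
  refine (abs_add_le _ _).trans ?_
  rw [abs_mul, abs_mul]
  have h1 := (mul_le_of_le_one_right (abs_nonneg (A θ - A (Real.pi / 2)))
    (Real.abs_cos_le_one (N * θ))).trans hA'
  have h2 := (mul_le_of_le_one_right (abs_nonneg (B θ - B (Real.pi / 2)))
    (Real.abs_sin_le_one (N * θ))).trans hB'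
  refine (add_le_add h1 h2).trans (le_of_eq ?_)
  ring

/-- The Riemann–Lebesgue lemma for the indicator function of a set, in real form. -/
lemma tendsto_setIntegral_cos_sin {S : Set ℝ} (hS : MeasurableSet S) (hfin : volume S ≠ ⊤) :
    Tendsto (fun N : ℝ => ∫ θ in S, Real.cos (2 * (N * θ))) atTop (𝓝 0) ∧
      Tendsto (fun N : ℝ => ∫ θ in S, Real.sin (2 * (N * θ))) atTop (𝓝 0) := by
  have h := Real.tendsto_integral_exp_smul_cocompact (S.indicator fun _ => (1 : ℂ))
  have h1 : Tendsto (fun N : ℝ => -N / Real.pi) atTop (cocompact ℝ) := by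
    have : Tendsto (fun N : ℝ => -N / Real.pi) atTop atBot :=
      tendsto_neg_atTop_atBot.atBot_div_const Real.pi_pos
    exact this.mono_right atBot_le_cocompact
  have h2 := h.comp h1
  have h3 : ∀ N : ℝ, (∫ x : ℝ, Real.fourierChar (-(x * (-N / Real.pi))) •
      S.indicator (fun _ => (1 : ℂ)) x)
      = ∫ θ in S, Complex.exp (((2 * (N * θ) : ℝ) : ℂ) * Complex.I) := by
    intro N
    rw [← integral_indicator hS]
    congr 1 with x
    by_cases hx : x ∈ S
    · rw [Set.indicator_of_mem hx, Set.indicator_of_mem hx, Circle.smul_def, Real.fourierChar_apply,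
        smul_eq_mul, mul_one]
      congr 3
      field_simp
    · rw [Set.indicator_of_notMem hx, Set.indicator_of_notMem hx, smul_zero]
  have hint : ∀ N : ℝ, IntegrableOn
      (fun θ : ℝ => Complex.exp (((2 * (N * θ) : ℝ) : ℂ) * Complex.I)) S := by
    intro N
    refine IntegrableOn.of_bound hfin.lt_top (by fun_prop) 1 (ae_of_all _ fun θ => ?_)
    rw [Complex.norm_exp_ofReal_mul_I]
  have h4 : Tendsto (fun N : ℝ => ∫ θ in S, Complex.exp (((2 * (N * θ) : ℝ) : ℂ) * Complex.I))
      atTop (𝓝 0) := h2.congr h3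
  constructor
  · have h5 := (Complex.continuous_re.tendsto 0).comp h4
    refine h5.congr fun N => ?_
    rw [Function.comp_apply]
    have := (integral_re (𝕜 := ℂ) (hint N)).symm
    simp only [RCLike.re_to_complex, Complex.exp_ofReal_mul_I_re] at this
    exact this
  · have h5 := (Complex.continuous_im.tendsto 0).comp h4
    refine h5.congr fun N => ?_
    rw [Function.comp_apply]
    have := (integral_im (𝕜 := ℂ) (hint N)).symm
    simp only [RCLike.im_to_complex, Complex.exp_ofReal_mul_I_im] at this
    exact this

/-- A pure oscillation has mean square close to half the square of its amplitude over a set on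
which the doubled frequency averages out. -/
lemma le_setIntegral_sq_pure_oscillation {S : Set ℝ} (hfin : volume S ≠ ⊤) {N A B : ℝ}
    (hI : |∫ θ in S, Real.cos (2 * (N * θ))| ≤ (volume S).toReal / 8)
    (hJ : |∫ θ in S, Real.sin (2 * (N * θ))| ≤ (volume S).toReal / 8) :
    IntegrableOn (fun θ => (A * Real.cos (N * θ) + B * Real.sin (N * θ)) ^ 2) S ∧
      (volume S).toReal * (3 / 8 * (A ^ 2 + B ^ 2))
        ≤ ∫ θ in S, (A * Real.cos (N * θ) + B * Real.sin (N * θ)) ^ 2 := by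
  set m := (volume S).toReal with hm
  have hcc₀ : IntegrableOn (fun θ => Real.cos (2 * (N * θ))) S :=
    IntegrableOn.of_bound hfin.lt_top (by fun_prop) 1
      (ae_of_all _ fun θ => Real.abs_cos_le_one _)
  have hcc : IntegrableOn (fun θ => (A ^ 2 - B ^ 2) / 2 * Real.cos (2 * (N * θ))) S :=
    hcc₀.const_mul _
  have hss₀ : IntegrableOn (fun θ => Real.sin (2 * (N * θ))) S :=
    IntegrableOn.of_bound hfin.lt_top (by fun_prop) 1
      (ae_of_all _ fun θ => Real.abs_sin_le_one _)
  have hss : IntegrableOn (fun θ => A * B * Real.sin (2 * (N * θ))) S :=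
    hss₀.const_mul _
  have hcs : IntegrableOn (fun θ => (A ^ 2 - B ^ 2) / 2 * Real.cos (2 * (N * θ))
      + A * B * Real.sin (2 * (N * θ))) S := hcc.add hss
  have hgsq : ∀ θ, (A * Real.cos (N * θ) + B * Real.sin (N * θ)) ^ 2
      = (A ^ 2 + B ^ 2) / 2 + ((A ^ 2 - B ^ 2) / 2 * Real.cos (2 * (N * θ))
      + A * B * Real.sin (2 * (N * θ))) := by
    intro θ
    rw [Real.cos_two_mul, Real.sin_two_mul]
    have := Real.sin_sq_add_cos_sq (N * θ)
    linear_combination (B ^ 2) * this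
  have hconst : IntegrableOn (fun _ : ℝ => (A ^ 2 + B ^ 2) / 2) S := integrableOn_const hfin
  simp only [hgsq]
  refine ⟨hconst.add hcs, ?_⟩
  rw [integral_add hconst hcs, integral_add hcc hss, integral_const_mul, integral_const_mul,
    setIntegral_const, smul_eq_mul, show volume.real S = m from rfl]
  have hlow1 : -((A ^ 2 + B ^ 2) / 2 * (m / 8))
      ≤ (A ^ 2 - B ^ 2) / 2 * (∫ θ in S, Real.cos (2 * (N * θ))) := by
    refine (abs_le.1 ?_).1
    rw [abs_mul]
    refine mul_le_mul ?_ hI (abs_nonneg _) (by positivity)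
    rw [abs_le]
    constructor <;> nlinarith [sq_nonneg A, sq_nonneg B]
  have hlow2 : -((A ^ 2 + B ^ 2) / 2 * (m / 8))
      ≤ A * B * ∫ θ in S, Real.sin (2 * (N * θ)) := by
    refine (abs_le.1 ?_).1
    rw [abs_mul]
    refine mul_le_mul ?_ hJ (abs_nonneg _) (by positivity)
    rw [abs_le]
    constructor <;> nlinarith [sq_nonneg (A - B), sq_nonneg (A + B)]
  linarith

/-- A solution cannot be small on a set of positive measure: there its size is at least a fixed
fraction of its amplitude, once the frequency is large. -/
lemma eventually_amplitude_le {K ε : ℝ} (hK : 0 ≤ K) (hε : 0 < ε) (hε' : ε < Real.pi / 2)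
    {S : Set ℝ} (hS : MeasurableSet S) (hSε : S ⊆ Set.Icc ε (Real.pi - ε))
    (hpos : volume S ≠ 0) :
    ∃ N₀ : ℝ, ∀ (N : ℝ) (u v V : ℝ → ℝ), N₀ ≤ N → IsOscillation K N u v V →
      ∀ B : ℝ, (∀ θ ∈ S, |u θ| ≤ B) →
        √(v (Real.pi / 2) ^ 2 + N ^ 2 * u (Real.pi / 2) ^ 2) ≤ 4 * N * B := by
  obtain ⟨C, hC0, hC⟩ := exists_abs_sub_pure_oscillation_le hK hε hε'
  have hfin : volume S ≠ ⊤ := by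
    refine ((measure_mono hSε).trans_lt ?_).ne
    simp
  set m := (volume S).toReal with hm
  have hm0 : 0 < m := ENNReal.toReal_pos hpos hfin
  obtain ⟨hcos, hsin⟩ := tendsto_setIntegral_cos_sin hS hfin
  have e1 := hcos.abs.eventually_le_const (u := m / 8) (by rw [abs_zero]; positivity)
  have e2 := hsin.abs.eventually_le_const (u := m / 8) (by rw [abs_zero]; positivity)
  obtain ⟨N₀, hN₀⟩ := eventually_atTop.1
    ((e1.and e2).and ((eventually_ge_atTop (8 * C)).and (eventually_ge_atTop 1)))
  refine ⟨N₀, fun N u v V hN h B hB => ?_⟩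
  obtain ⟨⟨hI, hJ⟩, hNC, hN1⟩ := hN₀ N hN
  obtain ⟨A₀, B₀, hAB, hosc⟩ := hC N u v V hN1 h
  have hNpos : 0 < N := by linarith
  set R := √(A₀ ^ 2 + B₀ ^ 2) with hR
  have hR0 : 0 ≤ R := Real.sqrt_nonneg _
  have hRsq : R ^ 2 = A₀ ^ 2 + B₀ ^ 2 := Real.sq_sqrt (by positivity)
  have hamp : √(v (Real.pi / 2) ^ 2 + N ^ 2 * u (Real.pi / 2) ^ 2) = N * R := by
    rw [← hAB, Real.sqrt_mul (by positivity), Real.sqrt_sq hNpos.le]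
  rw [hamp]
  set g : ℝ → ℝ := fun θ => A₀ * Real.cos (N * θ) + B₀ * Real.sin (N * θ) with hg
  have hgR : ∀ θ, |g θ| ≤ R := by
    intro θ
    refine Real.abs_le_sqrt ?_
    simp only [hg]
    have := Real.sin_sq_add_cos_sq (N * θ)
    have h1 : A₀ ^ 2 + B₀ ^ 2 = (A₀ ^ 2 + B₀ ^ 2)
        * (Real.sin (N * θ) ^ 2 + Real.cos (N * θ) ^ 2) := by rw [this, mul_one]
    rw [h1]
    nlinarith [sq_nonneg (A₀ * Real.sin (N * θ) - B₀ * Real.cos (N * θ))]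
  -- `|g| ≤ R` turns the bound for `|u|`, hence for `|g|`, into one for `g²`, whose mean is known.
  have hpt : ∀ θ ∈ S, g θ ^ 2 ≤ R * (B + C / N * R) := by
    intro θ hθ
    have h1 := hosc θ (hSε hθ)
    have h2 : |g θ| ≤ B + C / N * R := by
      have : g θ = u θ - (u θ - g θ) := by ring
      rw [this]
      exact (abs_sub _ _).trans (add_le_add (hB θ hθ) h1)
    rw [← sq_abs, sq]
    exact mul_le_mul (hgR θ) h2 (abs_nonneg _) hR0
  obtain ⟨hgint, hlow⟩ := le_setIntegral_sq_pure_oscillation hfin (A := A₀) (B := B₀) hI hJ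
  rw [← hRsq] at hlow
  have hintle : ∫ θ in S, g θ ^ 2 ≤ m * (R * (B + C / N * R)) := by
    have := setIntegral_mono_on hgint (integrableOn_const hfin) hS hpt
    rwa [setIntegral_const, smul_eq_mul] at this
  have hmain : m * (3 / 8 * R ^ 2) ≤ m * (R * (B + C / N * R)) := hlow.trans hintle
  have hmain' := le_of_mul_le_mul_left hmain hm0
  have hCN : C / N ≤ 1 / 8 := by
    rw [div_le_iff₀ hNpos]; linarith
  have hB0 : 0 ≤ B := by
    obtain ⟨θ, hθ⟩ := nonempty_of_measure_ne_zero hpos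
    exact (abs_nonneg _).trans (hB θ hθ)
  have hfinal : R ≤ 4 * B := by
    rcases hR0.eq_or_lt with h0 | h0
    · rw [← h0]; positivity
    · have h3 : R * (C / N * R) ≤ R * (1 / 8 * R) := by gcongr
      have h4 : R * (1 / 4 * R) ≤ R * B := by nlinarith
      have := le_of_mul_le_mul_left h4 h0
      linarith
  nlinarith

/-! ### Jacobi polynomials as oscillations -/

/-- The function `sin (θ/2) ^ a cos (θ/2) ^ b q (sin² (θ/2))`. For `a = α + 1/2`, `b = β + 1/2` and
`q (t) = P_n (1 - 2 t)` it is the Jacobi polynomial at `cos θ` times the square root of the weight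
with respect to `dθ`, up to a constant. -/
noncomputable def jacobiWave (a b : ℝ) (q : Polynomial ℝ) (θ : ℝ) : ℝ :=
  Real.sin (θ / 2) ^ a * Real.cos (θ / 2) ^ b * q.eval (Real.sin (θ / 2) ^ 2)

/-- The derivative of `jacobiWave a b q`. -/
noncomputable def jacobiWaveDeriv (a b : ℝ) (q : Polynomial ℝ) (θ : ℝ) : ℝ :=
  Real.sin (θ / 2) ^ a * Real.cos (θ / 2) ^ b *
    (q.derivative.eval (Real.sin (θ / 2) ^ 2) * (Real.sin (θ / 2) * Real.cos (θ / 2)) +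
      (a * (Real.cos (θ / 2) / Real.sin (θ / 2)) - b * (Real.sin (θ / 2) / Real.cos (θ / 2))) / 2 *
        q.eval (Real.sin (θ / 2) ^ 2))

/-- The potential in the equation of `jacobiWave a b q`. -/
noncomputable def jacobiPotential (a b θ : ℝ) : ℝ :=
  ((a - a ^ 2) / Real.sin (θ / 2) ^ 2 + (b - b ^ 2) / Real.cos (θ / 2) ^ 2) / 4

lemma sin_half_pos {θ : ℝ} (hθ : θ ∈ Set.Ioo 0 Real.pi) : 0 < Real.sin (θ / 2) :=
  Real.sin_pos_of_pos_of_lt_pi (by linarith [hθ.1]) (by linarith [hθ.1, hθ.2])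

lemma cos_half_pos {θ : ℝ} (hθ : θ ∈ Set.Ioo 0 Real.pi) : 0 < Real.cos (θ / 2) :=
  Real.cos_pos_of_mem_Ioo ⟨by linarith [hθ.1, Real.pi_pos], by linarith [hθ.2]⟩

lemma sin_eq_two_mul_half (θ : ℝ) :
    Real.sin θ = 2 * Real.sin (θ / 2) * Real.cos (θ / 2) := by
  rw [← Real.sin_two_mul]; ring_nf

section Derivatives

variable {a b θ : ℝ} {q : Polynomial ℝ}

lemma hasDerivAt_sin_half (θ : ℝ) :
    HasDerivAt (fun θ => Real.sin (θ / 2)) (Real.cos (θ / 2) / 2) θ := by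
  refine (((hasDerivAt_id θ).div_const 2).sin).congr_deriv ?_
  simp only [id]; ring

lemma hasDerivAt_cos_half (θ : ℝ) :
    HasDerivAt (fun θ => Real.cos (θ / 2)) (-(Real.sin (θ / 2) / 2)) θ := by
  refine (((hasDerivAt_id θ).div_const 2).cos).congr_deriv ?_
  simp only [id]; ring

lemma hasDerivAt_rpow_mul_rpow_half (hθ : θ ∈ Set.Ioo 0 Real.pi) :
    HasDerivAt (fun θ => Real.sin (θ / 2) ^ a * Real.cos (θ / 2) ^ b)
      (Real.sin (θ / 2) ^ a * Real.cos (θ / 2) ^ b *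
        ((a * (Real.cos (θ / 2) / Real.sin (θ / 2))
          - b * (Real.sin (θ / 2) / Real.cos (θ / 2))) / 2)) θ := by
  have hs := sin_half_pos hθ
  have hc := cos_half_pos hθ
  refine (((hasDerivAt_sin_half θ).rpow_const (p := a) (Or.inl hs.ne')).mul
    ((hasDerivAt_cos_half θ).rpow_const (p := b) (Or.inl hc.ne'))).congr_deriv ?_
  rw [Real.rpow_sub_one hs.ne', Real.rpow_sub_one hc.ne']
  ring

lemma hasDerivAt_eval_sin_half_sq (q : Polynomial ℝ) (θ : ℝ) :
    HasDerivAt (fun θ => q.eval (Real.sin (θ / 2) ^ 2))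
      (q.derivative.eval (Real.sin (θ / 2) ^ 2) * (Real.sin (θ / 2) * Real.cos (θ / 2))) θ := by
  refine ((q.hasDerivAt (Real.sin (θ / 2) ^ 2)).comp θ
    ((hasDerivAt_sin_half θ).pow 2)).congr_deriv ?_
  push_cast
  ring

lemma hasDerivAt_jacobiWave (hθ : θ ∈ Set.Ioo 0 Real.pi) :
    HasDerivAt (jacobiWave a b q) (jacobiWaveDeriv a b q θ) θ := by
  refine ((hasDerivAt_rpow_mul_rpow_half hθ).mul (hasDerivAt_eval_sin_half_sq q θ)).congr_deriv ?_
  rw [jacobiWaveDeriv]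
  ring

/-- The hypergeometric equation in Liouville normal form. -/
lemma hasDerivAt_jacobiWaveDeriv {l : ℝ} (hq : IsHypergeometric (a + 1 / 2) (a + b) l q)
    (hθ : θ ∈ Set.Ioo 0 Real.pi) :
    HasDerivAt (jacobiWaveDeriv a b q)
      (-(l + (a + b) ^ 2 / 4 + jacobiPotential a b θ) * jacobiWave a b q θ) θ := by
  have hs := sin_half_pos hθ
  have hc := cos_half_pos hθ
  have h1 := (hasDerivAt_eval_sin_half_sq q.derivative θ).mul
    ((hasDerivAt_sin_half θ).mul (hasDerivAt_cos_half θ))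
  have h2 := (((((hasDerivAt_cos_half θ).div (hasDerivAt_sin_half θ) hs.ne').const_mul a).sub
    (((hasDerivAt_sin_half θ).div (hasDerivAt_cos_half θ) hc.ne').const_mul b)).div_const 2).mul
    (hasDerivAt_eval_sin_half_sq q θ)
  refine ((hasDerivAt_rpow_mul_rpow_half (a := a) (b := b) hθ).mul (h1.add h2)).congr_deriv ?_
  simp only [Pi.mul_apply, Pi.div_apply, Pi.sub_apply, Pi.add_apply]
  have hode := hq.eval (Real.sin (θ / 2) ^ 2)
  rw [jacobiWave, jacobiPotential]
  generalize Real.sin (θ / 2) ^ a * Real.cos (θ / 2) ^ b = ρ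
  have hsc := Real.sin_sq_add_cos_sq (θ / 2)
  generalize Real.sin (θ / 2) = s at *
  generalize Real.cos (θ / 2) = c at *
  have hc2 : c ^ 2 = 1 - s ^ 2 := by linarith
  generalize q.eval (s ^ 2) = Q at *
  generalize q.derivative.eval (s ^ 2) = Q1 at *
  generalize q.derivative.derivative.eval (s ^ 2) = Q2 at *
  have e : l * Q = -(s ^ 2 * c ^ 2 * Q2 + (a + 1 / 2 - (a + b + 1) * s ^ 2) * Q1) := by
    rw [hc2]; linarith
  have hcc : c * c = 1 - s ^ 2 := by rw [← hc2]; ring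
  -- The equation eliminates `l`; what remains is an identity modulo `s² + c² = 1`.
  have e2 : -(l + (a + b) ^ 2 / 4 + ((a - a ^ 2) / s ^ 2 + (b - b ^ 2) / c ^ 2) / 4) * (ρ * Q)
      = ρ * ((s ^ 2 * c ^ 2 * Q2 + (a + 1 / 2 - (a + b + 1) * s ^ 2) * Q1)
        - ((a + b) ^ 2 / 4 + ((a - a ^ 2) / s ^ 2 + (b - b ^ 2) / c ^ 2) / 4) * Q) := by
    linear_combination (-ρ) * e
  rw [e2]
  field_simp
  have hc4 : c ^ 4 = (1 - s ^ 2) ^ 2 := by rw [← hc2]; ring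
  ring_nf
  simp only [hc2, hc4]
  ring

end Derivatives

lemma isOscillation_jacobiWave {a b l N : ℝ} {q : Polynomial ℝ}
    (hq : IsHypergeometric (a + 1 / 2) (a + b) l q) (hN : l + (a + b) ^ 2 / 4 = N ^ 2) :
    IsOscillation (|a - a ^ 2| + |b - b ^ 2|) N (jacobiWave a b q) (jacobiWaveDeriv a b q)
      (jacobiPotential a b) where
  hasDerivAt_fst _ hθ := hasDerivAt_jacobiWave hθ
  hasDerivAt_snd θ hθ := by
    have := hasDerivAt_jacobiWaveDeriv hq hθ
    rwa [hN] at this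
  abs_potential_le θ hθ := by
    have hs := sin_half_pos hθ
    have hc := cos_half_pos hθ
    rw [jacobiPotential, sin_eq_two_mul_half θ, abs_div, abs_of_pos (by norm_num : (0 : ℝ) < 4)]
    set s := Real.sin (θ / 2)
    set c := Real.cos (θ / 2)
    have hsc : s ^ 2 + c ^ 2 = 1 := Real.sin_sq_add_cos_sq _
    have h1 : |(a - a ^ 2) / s ^ 2 + (b - b ^ 2) / c ^ 2|
        ≤ |a - a ^ 2| / s ^ 2 + |b - b ^ 2| / c ^ 2 := by
      refine (abs_add_le _ _).trans (le_of_eq ?_)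
      rw [abs_div, abs_div, abs_of_pos (pow_pos hs 2), abs_of_pos (pow_pos hc 2)]
    have h2 : ∀ x y : ℝ, (x + y) / (2 * s * c) ^ 2
        = (x / s ^ 2 + y / c ^ 2) / 4 + (x / c ^ 2 + y / s ^ 2) / 4 := by
      intro x y
      rw [show (2 * s * c) ^ 2 = 4 * (s ^ 2 * c ^ 2) by ring]
      field_simp
      linear_combination (-(x + y)) * hsc
    rw [h2]
    have h3 : 0 ≤ (|a - a ^ 2| / c ^ 2 + |b - b ^ 2| / s ^ 2) / 4 := by positivity
    linarith

/-- The point `θ₀` with `sin (θ₀ / 2) = 1 / (3 N)`, where the polynomial regime at the end point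
meets the oscillatory regime. -/
noncomputable def transitionPoint (N : ℝ) : ℝ := 2 * Real.arcsin (1 / (3 * N))

section Transition

variable {N : ℝ}

lemma inv_three_mul_mem (hN : 1 ≤ N) : 0 < 1 / (3 * N) ∧ 1 / (3 * N) ≤ 1 / 3 := by
  constructor
  · positivity
  · exact one_div_le_one_div_of_le (by norm_num) (by linarith)

lemma sin_half_transitionPoint (hN : 1 ≤ N) : Real.sin (transitionPoint N / 2) = 1 / (3 * N) := by
  obtain ⟨h0, h1⟩ := inv_three_mul_mem hN
  rw [transitionPoint, mul_div_cancel_left₀ _ two_ne_zero, Real.sin_arcsin] <;> linarith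

lemma transitionPoint_mem (hN : 1 ≤ N) :
    0 < transitionPoint N ∧ transitionPoint N < Real.pi / 2 := by
  obtain ⟨h0, h1⟩ := inv_three_mul_mem hN
  constructor
  · rw [transitionPoint]
    have := Real.arcsin_pos.2 h0
    positivity
  · have h2 : Real.arcsin (1 / (3 * N)) < Real.pi / 4 := by
      rw [Real.arcsin_lt_iff_lt_sin' ⟨by linarith [Real.pi_pos], by linarith [Real.pi_pos]⟩,
        Real.sin_pi_div_four]
      have : (1 : ℝ) < √2 := by
        rw [Real.lt_sqrt] <;> norm_num
      linarith
    rw [transitionPoint]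
    linarith

lemma nine_tenths_le_cos_half_transitionPoint (hN : 1 ≤ N) :
    9 / 10 ≤ Real.cos (transitionPoint N / 2) := by
  obtain ⟨h0, h1⟩ := inv_three_mul_mem hN
  obtain ⟨h2, h3⟩ := transitionPoint_mem hN
  have hc := cos_half_pos ⟨h2, by linarith⟩
  have hsc := Real.sin_sq_add_cos_sq (transitionPoint N / 2)
  rw [sin_half_transitionPoint hN] at hsc
  nlinarith

lemma one_div_sin_transitionPoint_le (hN : 1 ≤ N) :
    1 / Real.sin (transitionPoint N) ≤ 2 * N := by
  have h1 := nine_tenths_le_cos_half_transitionPoint hN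
  rw [sin_eq_two_mul_half, sin_half_transitionPoint hN, div_le_iff₀ (by positivity)]
  have h2 : 2 * N * (2 * (1 / (3 * N)) * Real.cos (transitionPoint N / 2))
      = 4 / 3 * Real.cos (transitionPoint N / 2) := by
    field_simp
    ring
  linarith

end Transition

section Amplitude

variable {a b : ℝ} {n : ℕ} {q : Polynomial ℝ}

/-- The frequency `n + (a + b) / 2` of the wave belonging to degree `n`. -/
noncomputable def frequency (a b : ℝ) (n : ℕ) : ℝ := n + (a + b) / 2

lemma one_le_frequency (ha : 0 ≤ a) (hb : 0 ≤ b) (hn : 1 ≤ n) : 1 ≤ frequency a b n := by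
  have : (1 : ℝ) ≤ n := by exact_mod_cast hn
  rw [frequency]
  linarith

lemma eigenvalue_add_eq_sq_frequency (a b : ℝ) (n : ℕ) :
    n * (n + (a + b)) + (a + b) ^ 2 / 4 = frequency a b n ^ 2 := by
  rw [frequency]; ring

lemma eigenvalue_mul_le (ha : 0 ≤ a) (hb : 0 ≤ b) (hn : 1 ≤ n) {t : ℝ} (ht : 0 ≤ t)
    (ht' : t ≤ 1 / (3 * frequency a b n)) : 2 * (n * (n + (a + b))) * t ^ 2 ≤ 1 / 3 := by
  have hN := one_le_frequency ha hb hn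
  have h1 : n * (n + (a + b)) ≤ frequency a b n ^ 2 := by
    rw [← eigenvalue_add_eq_sq_frequency]
    have : 0 ≤ (a + b) ^ 2 / 4 := by positivity
    linarith
  have h2 : t ^ 2 ≤ (1 / (3 * frequency a b n)) ^ 2 := by gcongr
  have h3 : 0 ≤ n * (n + (a + b)) := by positivity
  calc 2 * (n * (n + (a + b))) * t ^ 2
      ≤ 2 * frequency a b n ^ 2 * (1 / (3 * frequency a b n)) ^ 2 := by gcongr
    _ = 2 / 9 := by field_simp; norm_num
    _ ≤ 1 / 3 := by norm_num

/-- Near an end point the polynomial is comparable with its value at the end point. -/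
lemma IsHypergeometric.abs_eval_sq_bounds {c : ℝ}
    (hq : IsHypergeometric c (a + b) (n * (n + (a + b))) q) (hc : 1 / 2 ≤ c) (ha : 0 ≤ a) (hb : 0 ≤ b) (hn : 1 ≤ n) {t : ℝ} (ht : 0 ≤ t)
    (ht' : t ≤ 1 / (3 * frequency a b n)) :
    |q.coeff 0| / 2 ≤ |q.eval (t ^ 2)| ∧ |q.eval (t ^ 2)| ≤ 3 / 2 * |q.coeff 0| := by
  have h := hq.abs_eval_sub_le hc (by positivity) (sq_nonneg t) (eigenvalue_mul_le ha hb hn ht ht')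
  have h1 := abs_sub_abs_le_abs_sub (q.eval (t ^ 2)) (q.coeff 0)
  have h2 := abs_sub_abs_le_abs_sub (q.coeff 0) (q.eval (t ^ 2))
  rw [abs_sub_comm] at h2
  constructor <;> linarith

lemma energy_transitionPoint_le (ha : 0 ≤ a) (hb : 0 ≤ b) (hn : 1 ≤ n)
    (hq : IsHypergeometric (a + 1 / 2) (a + b) (n * (n + (a + b))) q) :
    jacobiWaveDeriv a b q (transitionPoint (frequency a b n)) ^ 2 +
        frequency a b n ^ 2 * jacobiWave a b q (transitionPoint (frequency a b n)) ^ 2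
      ≤ ((3 + 3 * a + b) * (frequency a b n *
        ((1 / (3 * frequency a b n)) ^ a * |q.coeff 0|))) ^ 2 := by
  have hN := one_le_frequency ha hb hn
  set N := frequency a b n with hNdef
  have hN0 : 0 < N := by linarith
  have hs := sin_half_transitionPoint hN
  have hc := nine_tenths_le_cos_half_transitionPoint hN
  have hc1 := Real.cos_le_one (transitionPoint N / 2)
  obtain ⟨hs0, hs1⟩ := inv_three_mul_mem hN
  obtain ⟨-, hup⟩ := hq.abs_eval_sq_bounds (by linarith) ha hb hn hs0.le (le_of_eq (by rw [hNdef]))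
  have hder := hq.abs_eval_derivative_le (by linarith) (by positivity) (sq_nonneg (1 / (3 * N)))
    (eigenvalue_mul_le ha hb hn hs0.le (le_of_eq (by rw [hNdef])))
  have hl : n * (n + (a + b)) ≤ N ^ 2 := by
    rw [hNdef, ← eigenvalue_add_eq_sq_frequency]
    have : 0 ≤ (a + b) ^ 2 / 4 := by positivity
    linarith
  rw [jacobiWaveDeriv, jacobiWave, hs]
  set c := Real.cos (transitionPoint N / 2)
  set ρ := (1 / (3 * N)) ^ a
  have hρ : 0 ≤ ρ := by positivity
  have hcb : c ^ b ≤ 1 := Real.rpow_le_one (by linarith) hc1 hb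
  have hcb0 : 0 ≤ c ^ b := Real.rpow_nonneg (by linarith) _
  have hρc : ρ * c ^ b ≤ ρ := mul_le_of_le_one_right hρ hcb
  set y := |q.coeff 0|
  have hy : 0 ≤ y := abs_nonneg _
  -- the derivative term is at most `3 N² y · 1 / (3 N)`
  have h1 : |q.derivative.eval ((1 / (3 * N)) ^ 2) * (1 / (3 * N) * c)| ≤ N * y := by
    rw [abs_mul, abs_of_nonneg (by positivity : 0 ≤ 1 / (3 * N) * c)]
    calc _ ≤ 3 * N ^ 2 * y * (1 / (3 * N) * 1) := by
          gcongr
          exact hder.trans (by gcongr)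
      _ = N * y := by field_simp
  have h2 : |(a * (c / (1 / (3 * N))) - b * (1 / (3 * N) / c)) / 2| ≤ (3 * a + b) / 2 * N := by
    have h3 : c / (1 / (3 * N)) ≤ 3 * N := by
      rw [div_div_eq_mul_div, div_one]
      exact mul_le_of_le_one_left (by positivity) hc1
    have h4 : 1 / (3 * N) / c ≤ N := by
      rw [div_le_iff₀ (by linarith)]
      nlinarith
    have h5 : 0 ≤ c / (1 / (3 * N)) := by positivity
    have h6 : 0 ≤ 1 / (3 * N) / c := by positivity
    rw [abs_le]
    constructor <;> nlinarith [mul_le_mul_of_nonneg_left h3 ha, mul_le_mul_of_nonneg_left h4 hb,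
      mul_nonneg ha h5, mul_nonneg hb h6, mul_nonneg ha hN0.le, mul_nonneg hb hN0.le]
  have h7 : |q.derivative.eval ((1 / (3 * N)) ^ 2) * (1 / (3 * N) * c) +
      (a * (c / (1 / (3 * N))) - b * (1 / (3 * N) / c)) / 2 * q.eval ((1 / (3 * N)) ^ 2)|
      ≤ N * y + (3 * a + b) / 2 * N * (3 / 2 * y) := by
    refine (abs_add_le _ _).trans (add_le_add h1 ?_)
    rw [abs_mul]
    exact mul_le_mul h2 hup (abs_nonneg _) (by positivity)
  have h8 : (ρ * c ^ b * (q.derivative.eval ((1 / (3 * N)) ^ 2) * (1 / (3 * N) * c) +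
      (a * (c / (1 / (3 * N))) - b * (1 / (3 * N) / c)) / 2 * q.eval ((1 / (3 * N)) ^ 2))) ^ 2
      ≤ (ρ * (N * y + (3 * a + b) / 2 * N * (3 / 2 * y))) ^ 2 := by
    rw [← sq_abs, abs_mul, abs_of_nonneg (by positivity : 0 ≤ ρ * c ^ b)]
    gcongr
  have h9 : N ^ 2 * (ρ * c ^ b * q.eval ((1 / (3 * N)) ^ 2)) ^ 2
      ≤ (ρ * (N * (3 / 2 * y))) ^ 2 := by
    rw [← mul_pow, ← sq_abs, abs_mul, abs_mul, abs_of_pos hN0,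
      abs_of_nonneg (by positivity : 0 ≤ ρ * c ^ b)]
    have : N * (ρ * c ^ b * |q.eval ((1 / (3 * N)) ^ 2)|) ≤ ρ * (N * (3 / 2 * y)) := by
      calc _ ≤ N * (ρ * (3 / 2 * y)) := by gcongr
        _ = _ := by ring
    gcongr
  refine (add_le_add h8 h9).trans ?_
  have h10 : (ρ * (N * y + (3 * a + b) / 2 * N * (3 / 2 * y))) ^ 2
      + (ρ * (N * (3 / 2 * y))) ^ 2
      = ((1 + (3 * a + b) * (3 / 4)) ^ 2 + 9 / 4) * (N * (ρ * y)) ^ 2 := by ring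
  rw [h10, mul_pow (3 + 3 * a + b)]
  refine mul_le_mul_of_nonneg_right ?_ (sq_nonneg _)
  have : 0 ≤ 3 * a + b := by positivity
  nlinarith

lemma le_energy_transitionPoint (ha : 0 ≤ a) (hb : 0 ≤ b) (hn : 1 ≤ n)
    (hq : IsHypergeometric (a + 1 / 2) (a + b) (n * (n + (a + b))) q) :
    ((9 / 10) ^ b / 2 * (frequency a b n *
        ((1 / (3 * frequency a b n)) ^ a * |q.coeff 0|))) ^ 2 ≤
    jacobiWaveDeriv a b q (transitionPoint (frequency a b n)) ^ 2 +
        frequency a b n ^ 2 * jacobiWave a b q (transitionPoint (frequency a b n)) ^ 2 := by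
  have hN := one_le_frequency ha hb hn
  set N := frequency a b n with hNdef
  have hN0 : 0 < N := by linarith
  have hs := sin_half_transitionPoint hN
  have hc := nine_tenths_le_cos_half_transitionPoint hN
  obtain ⟨hs0, hs1⟩ := inv_three_mul_mem hN
  obtain ⟨hlo, -⟩ := hq.abs_eval_sq_bounds (by linarith) ha hb hn hs0.le (le_of_eq (by rw [hNdef]))
  refine le_add_of_nonneg_of_le (sq_nonneg _) ?_
  rw [jacobiWave, hs, ← mul_pow, ← sq_abs (N * _), abs_mul, abs_mul, abs_of_pos hN0,
    abs_of_nonneg (mul_nonneg (Real.rpow_nonneg hs0.le _)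
      (Real.rpow_nonneg (by linarith : (0 : ℝ) ≤ Real.cos (transitionPoint N / 2)) _))]
  set ρ := (1 / (3 * N)) ^ a
  have hρ : 0 ≤ ρ := by positivity
  have hcb : (9 / 10 : ℝ) ^ b ≤ Real.cos (transitionPoint N / 2) ^ b :=
    Real.rpow_le_rpow (by norm_num) hc hb
  have : (9 / 10) ^ b / 2 * (N * (ρ * |q.coeff 0|))
      ≤ N * (ρ * Real.cos (transitionPoint N / 2) ^ b * |q.eval ((1 / (3 * N)) ^ 2)|) := by
    calc (9 / 10) ^ b / 2 * (N * (ρ * |q.coeff 0|))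
        = N * (ρ * (9 / 10) ^ b * (|q.coeff 0| / 2)) := by ring
      _ ≤ _ := by gcongr
  gcongr

end Amplitude

/-- The wave of degree `n` is uniformly bounded by a multiple of
`(1 / (3 N)) ^ a |q(0)|`, and its amplitude in the middle of the interval is at least a multiple of
the same quantity. The energy is computed at the transition point and carried from there into
the oscillatory region; the regions next to the end points are covered by the comparison of the
polynomial with its value at the end point. -/
lemma exists_jacobiWave_bounds {a b : ℝ} (ha : 0 ≤ a) (hb : 0 ≤ b) :
    ∃ C c : ℝ, 0 < C ∧ 0 < c ∧ ∀ (n : ℕ) (q : Polynomial ℝ), 1 ≤ n →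
      IsHypergeometric (a + 1 / 2) (a + b) (n * (n + (a + b))) q →
      (∀ θ ∈ Set.Ioo 0 Real.pi, |jacobiWave a b q θ|
        ≤ C * ((1 / (3 * frequency a b n)) ^ a * |q.coeff 0|)) ∧
      c * (frequency a b n * ((1 / (3 * frequency a b n)) ^ a * |q.coeff 0|))
        ≤ √(jacobiWaveDeriv a b q (Real.pi / 2) ^ 2
          + frequency a b n ^ 2 * jacobiWave a b q (Real.pi / 2) ^ 2) := by
  -- The factor `4 K` comes from `|cot θ| ≤ 2 N` on `[θ₀, π - θ₀]`.
  set K := |a - a ^ 2| + |b - b ^ 2| with hK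
  have hK0 : 0 ≤ K := by positivity
  set E := Real.exp (4 * K) with hE
  have hE1 : 0 < E := Real.exp_pos _
  set C₁ := √E * (3 + 3 * a + b) with hC₁
  have hC₁0 : 0 ≤ C₁ := by positivity
  have h9 : (0 : ℝ) < (9 / 10) ^ a := by positivity
  refine ⟨3 / 2 + C₁ + 3 / (9 / 10) ^ a * C₁, (9 / 10) ^ b / 2 / √E, by positivity, by positivity,
    fun n q hn hq => ?_⟩
  have hN := one_le_frequency ha hb hn
  have hosc := isOscillation_jacobiWave hq (eigenvalue_add_eq_sq_frequency a b n)
  have hup := energy_transitionPoint_le ha hb hn hq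
  have hlow := le_energy_transitionPoint ha hb hn hq
  have hs := sin_half_transitionPoint hN
  have hc := nine_tenths_le_cos_half_transitionPoint hN
  have hL := one_div_sin_transitionPoint_le hN
  obtain ⟨hθ0, hθ1⟩ := transitionPoint_mem hN
  obtain ⟨hs0, hs1⟩ := inv_three_mul_mem hN
  have hend : ∀ t, 0 ≤ t → t ≤ 1 / (3 * frequency a b n) → |q.eval (t ^ 2)| ≤ 3 / 2 * |q.coeff 0| :=
    fun t h0 h1 => (hq.abs_eval_sq_bounds (by linarith) ha hb hn h0 h1).2
  set N := frequency a b n with hNdef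
  have hN0 : 0 < N := by linarith
  set θ₀ := transitionPoint N with hθ₀
  set D := (1 / (3 * N)) ^ a * |q.coeff 0| with hD
  have hD0 : 0 ≤ D := by positivity
  set u := jacobiWave a b q with hu
  set v := jacobiWaveDeriv a b q with hv
  have hmem₀ : θ₀ ∈ Set.Icc θ₀ (Real.pi - θ₀) := ⟨le_rfl, by linarith⟩
  have henergy : ∀ x ∈ Set.Icc θ₀ (Real.pi - θ₀), ∀ y ∈ Set.Icc θ₀ (Real.pi - θ₀),
      v y ^ 2 + N ^ 2 * u y ^ 2 ≤ E * (v x ^ 2 + N ^ 2 * u x ^ 2) := by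
    intro x hx y hy
    obtain ⟨hx1, -, hx2⟩ := abs_cot_le_of_mem_Icc hθ0 hθ1 hx
    obtain ⟨hy1, -, hy2⟩ := abs_cot_le_of_mem_Icc hθ0 hθ1 hy
    have h := hosc.energy_le hN0 hK0 hx1 hy1 (hx2.trans hL) (hy2.trans hL)
    rwa [show 2 * K * (2 * N) / N = 4 * K by field_simp; ring] at h
  -- the oscillatory region
  have hmiddle : ∀ θ ∈ Set.Icc θ₀ (Real.pi - θ₀), |u θ| ≤ C₁ * D := by
    intro θ hθ
    have h1 := (henergy θ₀ hmem₀ θ hθ).trans (mul_le_mul_of_nonneg_left hup hE1.le)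
    have h2 : (N * |u θ|) ^ 2 ≤ (N * (C₁ * D)) ^ 2 := by
      have h3 : (N * (C₁ * D)) ^ 2 = E * ((3 + 3 * a + b) * (N * D)) ^ 2 := by
        rw [hC₁]
        have : √E ^ 2 = E := Real.sq_sqrt hE1.le
        linear_combination (N ^ 2 * (3 + 3 * a + b) ^ 2 * D ^ 2) * this
      rw [h3, mul_pow, sq_abs]
      linarith [sq_nonneg (v θ)]
    have h4 := le_of_sq_le_sq h2 (by positivity)
    exact le_of_mul_le_mul_left h4 hN0
  constructor
  · intro θ hθ
    have hsθ := sin_half_pos hθ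
    have hcθ := cos_half_pos hθ
    have hrest1 : 0 ≤ 3 / 2 * D := by positivity
    have hrest2 : 0 ≤ C₁ * D := by positivity
    have hrest3 : 0 ≤ 3 / (9 / 10) ^ a * C₁ * D := by positivity
    rw [show (3 / 2 + C₁ + 3 / (9 / 10) ^ a * C₁) * D
      = 3 / 2 * D + C₁ * D + 3 / (9 / 10) ^ a * C₁ * D by ring]
    have habs : |u θ| = Real.sin (θ / 2) ^ a * Real.cos (θ / 2) ^ b
        * |q.eval (Real.sin (θ / 2) ^ 2)| := by
      rw [hu, jacobiWave, abs_mul, abs_of_nonneg (by positivity)]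
    rcases le_or_gt θ₀ θ with h1 | h1
    · rcases le_or_gt θ (Real.pi - θ₀) with h2 | h2
      · have := hmiddle θ ⟨h1, h2⟩
        nlinarith
      · -- the region next to `π`, compared with the point `π - θ₀`
        have hr := hq.comp_one_sub
        rw [show a + b + 1 - (a + 1 / 2) = b + 1 / 2 by ring] at hr
        set r := q.comp (1 - Polynomial.X)
        have hreval : ∀ x : ℝ, q.eval (Real.sin (x / 2) ^ 2)
            = r.eval (Real.cos (x / 2) ^ 2) := by
          intro x
          simp only [r, Polynomial.eval_comp, Polynomial.eval_sub, Polynomial.eval_one,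
            Polynomial.eval_X]
          rw [← Real.sin_sq]
        have hcos₀ : Real.cos ((Real.pi - θ₀) / 2) = 1 / (3 * N) := by
          rw [sub_div, Real.cos_pi_div_two_sub, hs]
        have hsin₀ : Real.sin ((Real.pi - θ₀) / 2) = Real.cos (θ₀ / 2) := by
          rw [sub_div, Real.sin_pi_div_two_sub]
        have hcle : Real.cos (θ / 2) ≤ 1 / (3 * N) := by
          rw [← hcos₀]
          exact Real.cos_le_cos_of_nonneg_of_le_pi (by linarith) (by linarith [hθ.2, Real.pi_pos])
            (by linarith)
        have hb1 := (hr.abs_eval_sq_bounds (by linarith) ha hb hn hcθ.le hcle).2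
        have hb2 := (hr.abs_eval_sq_bounds (by linarith) ha hb hn hs0.le le_rfl).1
        have hu₀ : |u (Real.pi - θ₀)| = Real.cos (θ₀ / 2) ^ a * (1 / (3 * N)) ^ b
            * |r.eval ((1 / (3 * N)) ^ 2)| := by
          rw [hu, jacobiWave, hreval, hsin₀, hcos₀, abs_mul, abs_of_nonneg]
          exact mul_nonneg (Real.rpow_nonneg (by linarith) _) (Real.rpow_nonneg hs0.le _)
        have hu₁ := hmiddle (Real.pi - θ₀) ⟨by linarith, le_rfl⟩
        have hca : (9 / 10 : ℝ) ^ a ≤ Real.cos (θ₀ / 2) ^ a :=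
          Real.rpow_le_rpow (by norm_num) hc ha
        have hsa : Real.sin (θ / 2) ^ a ≤ 1 := Real.rpow_le_one hsθ.le (Real.sin_le_one _) ha
        have hcb : Real.cos (θ / 2) ^ b ≤ (1 / (3 * N)) ^ b :=
          Real.rpow_le_rpow hcθ.le hcle hb
        have h3 : |u θ| ≤ 3 * ((1 / (3 * N)) ^ b * |r.eval ((1 / (3 * N)) ^ 2)|) := by
          rw [habs, hreval]
          calc _ ≤ 1 * (1 / (3 * N)) ^ b * (3 * |r.eval ((1 / (3 * N)) ^ 2)|) := by
                gcongr
                linarith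
            _ = _ := by ring
        have h4 : (9 / 10) ^ a * ((1 / (3 * N)) ^ b * |r.eval ((1 / (3 * N)) ^ 2)|)
            ≤ C₁ * D := by
          refine le_trans ?_ hu₁
          rw [hu₀, mul_assoc]
          gcongr
        have h5 : |u θ| ≤ 3 / (9 / 10) ^ a * C₁ * D := by
          rw [show 3 / (9 / 10) ^ a * C₁ * D = 3 * (C₁ * D / (9 / 10) ^ a) by ring]
          refine h3.trans (mul_le_mul_of_nonneg_left ?_ (by norm_num))
          rw [le_div_iff₀ h9]
          linarith
        linarith
    · have hsle : Real.sin (θ / 2) ≤ 1 / (3 * N) := by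
        rw [← hs]
        exact Real.sin_le_sin_of_le_of_le_pi_div_two (by linarith [hθ.1, Real.pi_pos])
          (by linarith [Real.pi_pos]) (by linarith)
      have h2 : |u θ| ≤ 3 / 2 * D := by
        rw [habs]
        calc _ ≤ (1 / (3 * N)) ^ a * 1 * (3 / 2 * |q.coeff 0|) := by
              gcongr
              · exact Real.rpow_le_one hcθ.le (Real.cos_le_one _) hb
              · exact hend _ hsθ.le hsle
          _ = 3 / 2 * D := by rw [hD]; ring
      linarith
  · refine Real.le_sqrt_of_sq_le ?_
    have h1 := hlow.trans (henergy (Real.pi / 2) ⟨by linarith, by linarith⟩ θ₀ hmem₀)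
    have h2 : ((9 / 10) ^ b / 2 / √E * (N * D)) ^ 2
        = ((9 / 10) ^ b / 2 * (N * D)) ^ 2 / E := by
      rw [div_mul_eq_mul_div, div_pow, Real.sq_sqrt hE1.le]
    rw [h2, div_le_iff₀ hE1]
    linarith

/-! ### The Jacobi measure -/

/-- In terms of the wave, `P_n² dμ` has the density `u² / √(1 - x²)`, up to a constant. -/
lemma jacobiWave_arccos_sq {α β : ℝ} (n : ℕ) {x : ℝ} (hx : x ∈ Set.Ioo (-1 : ℝ) 1) :
    (jacobiPoly α β n).eval x ^ 2 * ((1 - x) ^ α * (1 + x) ^ β)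
      = 2 ^ (α + 1 / 2) * 2 ^ (β + 1 / 2) *
        jacobiWave (α + 1 / 2) (β + 1 / 2) (shiftedJacobi α β n) (Real.arccos x) ^ 2 *
        ((1 - x) ^ (-(1 / 2) : ℝ) * (1 + x) ^ (-(1 / 2) : ℝ)) := by
  have h1 : 0 < 1 - x := by linarith [hx.2]
  have h2 : 0 < 1 + x := by linarith [hx.1]
  have hcos : Real.cos (Real.arccos x) = x := Real.cos_arccos hx.1.le hx.2.le
  have hmem : Real.arccos x ∈ Set.Ioo 0 Real.pi :=
    ⟨Real.arccos_pos.2 hx.2, lt_of_le_of_ne (Real.arccos_le_pi x) fun h => by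
      rw [Real.arccos_eq_pi] at h; linarith [hx.1]⟩
  have hs := sin_half_pos hmem
  have hc := cos_half_pos hmem
  have hc2 : Real.cos (Real.arccos x / 2) ^ 2 = (1 + x) / 2 := by
    rw [Real.cos_sq, mul_div_cancel₀ _ two_ne_zero, hcos]; ring
  have hs2 : Real.sin (Real.arccos x / 2) ^ 2 = (1 - x) / 2 := by
    rw [Real.sin_sq, hc2]; ring
  have hpow : ∀ {y : ℝ} (e : ℝ), 0 < y → (y ^ e) ^ 2 = (y ^ 2) ^ e := by
    intro y e hy
    rw [← Real.rpow_natCast, ← Real.rpow_natCast, ← Real.rpow_mul hy.le, ← Real.rpow_mul hy.le,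
      mul_comm]
  rw [jacobiWave, mul_pow, mul_pow, hpow _ hs, hpow _ hc, hs2, hc2, eval_shiftedJacobi,
    show 1 - 2 * ((1 - x) / 2) = x by ring, Real.div_rpow h1.le zero_le_two,
    Real.div_rpow h2.le zero_le_two]
  have e1 : (1 - x) ^ α = (1 - x) ^ (α + 1 / 2) * (1 - x) ^ (-(1 / 2) : ℝ) := by
    rw [← Real.rpow_add h1]; congr 1; ring
  have e2 : (1 + x) ^ β = (1 + x) ^ (β + 1 / 2) * (1 + x) ^ (-(1 / 2) : ℝ) := by
    rw [← Real.rpow_add h2]; congr 1; ring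
  rw [e1, e2]
  have h3 : (2 : ℝ) ^ (α + 1 / 2) ≠ 0 := (Real.rpow_pos_of_pos two_pos _).ne'
  have h4 : (2 : ℝ) ^ (β + 1 / 2) ≠ 0 := (Real.rpow_pos_of_pos two_pos _).ne'
  generalize (2 : ℝ) ^ (α + 1 / 2) = A at *
  generalize (2 : ℝ) ^ (β + 1 / 2) = B at *
  field_simp

/-- An integrable majorant of `(1 - x²) ^ (-1/2)`. -/
noncomputable def arcsineMajorant (x : ℝ) : ℝ :=
  (1 - x) ^ (-(1 / 2) : ℝ) + (1 + x) ^ (-(1 / 2) : ℝ)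

lemma integrableOn_arcsineMajorant : IntegrableOn arcsineMajorant (Set.Icc (-1) 1) := by
  have h0 : IntervalIntegrable (fun x : ℝ => x ^ (-(1 / 2) : ℝ)) volume 0 2 :=
    intervalIntegral.intervalIntegrable_rpow' (by norm_num)
  have h1 := (h0.comp_sub_left 1).symm
  have h2 := h0.comp_add_left 1
  norm_num at h1 h2
  have h3 : IntervalIntegrable arcsineMajorant volume (-1) 1 := by
    refine IntervalIntegrable.add ?_ ?_
    · convert h1 using 3
    · convert h2 using 3
  rwa [intervalIntegrable_iff_integrableOn_Icc_of_le (by norm_num)] at h3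

lemma mul_rpow_neg_half_le {x : ℝ} (hx : x ∈ Set.Ioo (-1 : ℝ) 1) :
    (1 - x) ^ (-(1 / 2) : ℝ) * (1 + x) ^ (-(1 / 2) : ℝ) ≤ arcsineMajorant x := by
  have h1 : 0 < 1 - x := by linarith [hx.2]
  have h2 : 0 < 1 + x := by linarith [hx.1]
  have p1 : 0 < (1 - x) ^ (-(1 / 2) : ℝ) := Real.rpow_pos_of_pos h1 _
  have p2 : 0 < (1 + x) ^ (-(1 / 2) : ℝ) := Real.rpow_pos_of_pos h2 _
  rw [arcsineMajorant]
  rcases le_total 0 x with h | h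
  · have : (1 + x) ^ (-(1 / 2) : ℝ) ≤ 1 :=
      Real.rpow_le_one_of_one_le_of_nonpos (by linarith) (by norm_num)
    nlinarith
  · have : (1 - x) ^ (-(1 / 2) : ℝ) ≤ 1 :=
      Real.rpow_le_one_of_one_le_of_nonpos (by linarith) (by norm_num)
    nlinarith

lemma ae_mem_Ioo_restrict_Icc :
    ∀ᵐ x ∂(volume.restrict (Set.Icc (-1 : ℝ) 1)), x ∈ Set.Ioo (-1 : ℝ) 1 := by
  rw [← restrict_Ioo_eq_restrict_Icc]
  exact ae_restrict_mem measurableSet_Ioo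

lemma measurable_weight (α β : ℝ) : Measurable fun x : ℝ => (1 - x) ^ α * (1 + x) ^ β := by
  fun_prop

lemma weight_nonneg (α β : ℝ) {x : ℝ} (hx : x ∈ Set.Ioo (-1 : ℝ) 1) :
    0 ≤ (1 - x) ^ α * (1 + x) ^ β := by
  have h1 : 0 < 1 - x := by linarith [hx.2]
  have h2 : 0 < 1 + x := by linarith [hx.1]
  positivity

lemma integral_jacobiMeasure (α β : ℝ) (g : ℝ → ℝ) :
    ∫ x, g x ∂(jacobiMeasure α β)
      = ∫ x in Set.Icc (-1) 1, g x * ((1 - x) ^ α * (1 + x) ^ β) := by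
  rw [jacobiMeasure, integral_withDensity_eq_integral_toReal_smul
    (measurable_weight α β).ennreal_ofReal (ae_of_all _ fun _ => ENNReal.ofReal_lt_top)]
  refine integral_congr_ae ?_
  filter_upwards [ae_mem_Ioo_restrict_Icc] with x hx
  rw [ENNReal.toReal_ofReal (weight_nonneg α β hx), smul_eq_mul, mul_comm]

lemma integrableOn_weight {α β : ℝ} (hα : -1 / 2 ≤ α) (hβ : -1 / 2 ≤ β) :
    IntegrableOn (fun x : ℝ => (1 - x) ^ α * (1 + x) ^ β) (Set.Icc (-1) 1) := by
  refine (integrableOn_arcsineMajorant.const_mul (2 ^ (α + 1 / 2) * 2 ^ (β + 1 / 2))).mono'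
    (measurable_weight α β).aestronglyMeasurable ?_
  filter_upwards [ae_mem_Ioo_restrict_Icc] with x hx
  have h1 : 0 < 1 - x := by linarith [hx.2]
  have h2 : 0 < 1 + x := by linarith [hx.1]
  have e1 : (1 - x) ^ α = (1 - x) ^ (α + 1 / 2) * (1 - x) ^ (-(1 / 2) : ℝ) := by
    rw [← Real.rpow_add h1]; congr 1; ring
  have e2 : (1 + x) ^ β = (1 + x) ^ (β + 1 / 2) * (1 + x) ^ (-(1 / 2) : ℝ) := by
    rw [← Real.rpow_add h2]; congr 1; ring
  rw [Real.norm_of_nonneg (weight_nonneg α β hx), e1, e2]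
  have h3 : (1 - x) ^ (α + 1 / 2) ≤ 2 ^ (α + 1 / 2) :=
    Real.rpow_le_rpow h1.le (by linarith [hx.1]) (by linarith)
  have h4 : (1 + x) ^ (β + 1 / 2) ≤ 2 ^ (β + 1 / 2) :=
    Real.rpow_le_rpow h2.le (by linarith [hx.2]) (by linarith)
  calc _ = (1 - x) ^ (α + 1 / 2) * (1 + x) ^ (β + 1 / 2) *
        ((1 - x) ^ (-(1 / 2) : ℝ) * (1 + x) ^ (-(1 / 2) : ℝ)) := by ring
    _ ≤ _ := by
      gcongr
      exact mul_rpow_neg_half_le hx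

lemma isFiniteMeasure_jacobiMeasure {α β : ℝ} (hα : -1 / 2 ≤ α) (hβ : -1 / 2 ≤ β) :
    IsFiniteMeasure (jacobiMeasure α β) := by
  refine isFiniteMeasure_withDensity_ofReal ?_
  exact (integrableOn_weight hα hβ).2

/-- The mass of a short interval next to the point `1`. -/
lemma ofReal_le_jacobiMeasure_Icc {α β : ℝ} (hα : -1 / 2 ≤ α) (hβ : -1 / 2 ≤ β) {η : ℝ}
    (hη : 0 < η) (hη' : η ≤ 1 / 2) :
    ENNReal.ofReal (η ^ (α + 1) / 2) ≤ jacobiMeasure α β (Set.Icc (1 - 2 * η) (1 - η)) := by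
  have hsub : Set.Icc (1 - 2 * η) (1 - η) ⊆ Set.Icc (-1) 1 :=
    Set.Icc_subset_Icc (by linarith) (by linarith)
  rw [jacobiMeasure, withDensity_apply _ measurableSet_Icc,
    Measure.restrict_restrict_of_subset hsub]
  have hlow : ∀ x ∈ Set.Icc (1 - 2 * η) (1 - η),
      ENNReal.ofReal (η ^ α / 2) ≤ ENNReal.ofReal ((1 - x) ^ α * (1 + x) ^ β) := by
    intro x hx
    have h1 : η ≤ 1 - x := by linarith [hx.2]
    have h1' : 1 - x ≤ 2 * η := by linarith [hx.1]
    have h2 : 1 ≤ 1 + x := by linarith [hx.1]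
    have h2' : 1 + x ≤ 2 := by linarith [hx.2]
    have hp1 : 0 < 1 - x := by linarith
    refine ENNReal.ofReal_le_ofReal ?_
    have e1 : (1 - x) ^ α = (1 - x) ^ (α + 1 / 2) * (1 - x) ^ (-(1 / 2) : ℝ) := by
      rw [← Real.rpow_add hp1]; congr 1; ring
    have e2 : (1 + x) ^ β = (1 + x) ^ (β + 1 / 2) * (1 + x) ^ (-(1 / 2) : ℝ) := by
      rw [← Real.rpow_add (by linarith)]; congr 1; ring
    have e3 : η ^ α / 2 = η ^ (α + 1 / 2) * (2 * η) ^ (-(1 / 2) : ℝ)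
        * (1 * 2 ^ (-(1 / 2) : ℝ)) := by
      rw [Real.mul_rpow zero_le_two hη.le]
      have : η ^ α = η ^ (α + 1 / 2) * η ^ (-(1 / 2) : ℝ) := by
        rw [← Real.rpow_add hη]; congr 1; ring
      rw [this]
      have h22 : (2 : ℝ) ^ (-(1 / 2) : ℝ) * 2 ^ (-(1 / 2) : ℝ) = 1 / 2 := by
        rw [← Real.rpow_add two_pos]
        norm_num [Real.rpow_neg_one]
      linear_combination (-(η ^ (α + 1 / 2) * η ^ (-(1 / 2) : ℝ))) * h22
    rw [e1, e2, e3]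
    have g1 : η ^ (α + 1 / 2) ≤ (1 - x) ^ (α + 1 / 2) :=
      Real.rpow_le_rpow hη.le h1 (by linarith)
    have g2 : (2 * η) ^ (-(1 / 2) : ℝ) ≤ (1 - x) ^ (-(1 / 2) : ℝ) :=
      Real.rpow_le_rpow_of_nonpos hp1 h1' (by norm_num)
    have g3 : 1 ≤ (1 + x) ^ (β + 1 / 2) := Real.one_le_rpow h2 (by linarith)
    have g4 : (2 : ℝ) ^ (-(1 / 2) : ℝ) ≤ (1 + x) ^ (-(1 / 2) : ℝ) :=
      Real.rpow_le_rpow_of_nonpos (by linarith) h2' (by norm_num)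
    gcongr
  refine le_trans (le_of_eq ?_) (setLIntegral_mono' measurableSet_Icc hlow)
  rw [setLIntegral_const, Real.volume_Icc, ← ENNReal.ofReal_mul (by positivity),
    show 1 - η - (1 - 2 * η) = η by ring, Real.rpow_add_one hη.ne']
  congr 1
  ring

lemma integrable_of_continuous_jacobiMeasure {α β : ℝ} (hα : -1 / 2 ≤ α) (hβ : -1 / 2 ≤ β)
    {g : ℝ → ℝ} (hg : Continuous g) : Integrable g (jacobiMeasure α β) := by
  have := isFiniteMeasure_jacobiMeasure hα hβ
  obtain ⟨C, hC⟩ := (isCompact_Icc (a := (-1 : ℝ)) (b := 1)).exists_bound_of_continuousOn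
    hg.continuousOn
  refine Integrable.of_bound hg.aestronglyMeasurable C ?_
  rw [jacobiMeasure]
  refine (withDensity_absolutelyContinuous _ _).ae_le ?_
  filter_upwards [ae_restrict_mem measurableSet_Icc] with x hx using hC x hx

/-! ### Size of the coefficients -/

/-- The frequency `N = n + (α + β + 1) / 2` belonging to the Jacobi polynomial of degree `n`. -/
noncomputable def jacobiFrequency (α β : ℝ) (n : ℕ) : ℝ := frequency (α + 1 / 2) (β + 1 / 2) n

/-- The quantity `(3 N) ^ (-α - 1/2) P_n(1)`, which gives the order of magnitude of the
oscillations of `P_n` inside the interval. -/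
noncomputable def jacobiSize (α β : ℝ) (n : ℕ) : ℝ :=
  (1 / (3 * jacobiFrequency α β n)) ^ (α + 1 / 2) * (jacobiPoly α β n).eval 1

variable {α β : ℝ}

lemma isHypergeometric_shiftedJacobi_half (α β : ℝ) (n : ℕ) :
    IsHypergeometric (α + 1 / 2 + 1 / 2) (α + 1 / 2 + (β + 1 / 2))
      (n * (n + (α + 1 / 2 + (β + 1 / 2)))) (shiftedJacobi α β n) := by
  have h := isHypergeometric_shiftedJacobi α β n
  rwa [show α + 1 = α + 1 / 2 + 1 / 2 by ring,
    show α + β + 1 = α + 1 / 2 + (β + 1 / 2) by ring] at h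

lemma abs_coeff_zero_shiftedJacobi (hα : -1 / 2 ≤ α) (n : ℕ) :
    |(shiftedJacobi α β n).coeff 0| = (jacobiPoly α β n).eval 1 := by
  rw [coeff_zero_shiftedJacobi, abs_of_pos (eval_one_jacobiPoly_pos (by linarith) β n)]

lemma one_le_jacobiFrequency (hα : -1 / 2 ≤ α) (hβ : -1 / 2 ≤ β) {n : ℕ} (hn : 1 ≤ n) :
    1 ≤ jacobiFrequency α β n :=
  one_le_frequency (by linarith) (by linarith) hn

lemma jacobiSize_pos (hα : -1 / 2 ≤ α) (hβ : -1 / 2 ≤ β) {n : ℕ} (hn : 1 ≤ n) :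
    0 < jacobiSize α β n := by
  have h1 := one_le_jacobiFrequency hα hβ hn
  have h2 := eval_one_jacobiPoly_pos (by linarith : -1 < α) β n
  rw [jacobiSize]
  positivity

lemma half_eval_one_le_eval_jacobiPoly (hα : -1 / 2 ≤ α) (hβ : -1 / 2 ≤ β) {n : ℕ} (hn : 1 ≤ n)
    {x : ℝ} (hx : x ≤ 1) (hx' : 1 - 2 * (1 / (3 * jacobiFrequency α β n)) ^ 2 ≤ x) :
    (jacobiPoly α β n).eval 1 / 2 ≤ (jacobiPoly α β n).eval x := by
  have ha : 0 ≤ α + 1 / 2 := by linarith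
  have hb : 0 ≤ β + 1 / 2 := by linarith
  have hN := one_le_jacobiFrequency hα hβ hn
  obtain ⟨hs0, -⟩ := inv_three_mul_mem hN
  have hq := isHypergeometric_shiftedJacobi_half α β n
  have hl : 2 * (n * (n + (α + 1 / 2 + (β + 1 / 2)))) * ((1 - x) / 2) ≤ 1 / 3 := by
    have h1 := eigenvalue_mul_le ha hb hn hs0.le (le_of_eq (by rw [jacobiFrequency]))
    have h2 : (1 - x) / 2 ≤ (1 / (3 * jacobiFrequency α β n)) ^ 2 := by linarith
    refine le_trans ?_ h1
    gcongr
  have h := hq.abs_eval_sub_le (by linarith) (by positivity) (by linarith : 0 ≤ (1 - x) / 2) hl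
  rw [abs_coeff_zero_shiftedJacobi hα, coeff_zero_shiftedJacobi, eval_shiftedJacobi,
    show 1 - 2 * ((1 - x) / 2) = x by ring] at h
  linarith [(abs_le.1 h).1]

lemma jacobiNormSq_pos (hα : -1 / 2 ≤ α) (hβ : -1 / 2 ≤ β) {n : ℕ} (hn : 1 ≤ n) :
    0 < jacobiNormSq α β n := by
  have hN := one_le_jacobiFrequency hα hβ hn
  obtain ⟨hs0, hs1⟩ := inv_three_mul_mem hN
  set η := (1 / (3 * jacobiFrequency α β n)) ^ 2 with hη
  have hη0 : 0 < η := by positivity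
  have hη1 : η ≤ 1 / 2 := by
    rw [hη]; nlinarith
  rw [jacobiNormSq, integral_pos_iff_support_of_nonneg (fun x => sq_nonneg _)
    (integrable_of_continuous_jacobiMeasure hα hβ ((jacobiPoly α β n).continuous.pow 2))]
  have hpos : 0 < ENNReal.ofReal (η ^ (α + 1) / 2) := ENNReal.ofReal_pos.2 (by positivity)
  refine (hpos.trans_le (ofReal_le_jacobiMeasure_Icc hα hβ hη0 hη1)).trans_le
    (measure_mono fun x hx => ?_)
  have h1 := half_eval_one_le_eval_jacobiPoly hα hβ hn (by linarith [hx.2] : x ≤ 1) hx.1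
  have h2 := eval_one_jacobiPoly_pos (by linarith : -1 < α) β n
  rw [Function.mem_support]
  have : 0 < (jacobiPoly α β n).eval x := by linarith
  positivity

/-- Upper bound for the norm and lower bound for the amplitude of the Jacobi polynomials, in terms
of the same quantity `jacobiSize α β n`. -/
lemma exists_jacobiNormSq_le (hα : -1 / 2 ≤ α) (hβ : -1 / 2 ≤ β) :
    ∃ C c : ℝ, 0 < C ∧ 0 < c ∧ ∀ n : ℕ, 1 ≤ n →
      jacobiNormSq α β n ≤ C * jacobiSize α β n ^ 2 ∧
      c * (jacobiFrequency α β n * jacobiSize α β n)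
        ≤ √(jacobiWaveDeriv (α + 1 / 2) (β + 1 / 2) (shiftedJacobi α β n) (Real.pi / 2) ^ 2
          + jacobiFrequency α β n ^ 2 *
            jacobiWave (α + 1 / 2) (β + 1 / 2) (shiftedJacobi α β n) (Real.pi / 2) ^ 2) := by
  have ha : 0 ≤ α + 1 / 2 := by linarith
  have hb : 0 ≤ β + 1 / 2 := by linarith
  obtain ⟨C, c, hC, hc, h⟩ := exists_jacobiWave_bounds ha hb
  set A : ℝ := 2 ^ (α + 1 / 2) * 2 ^ (β + 1 / 2) with hA
  have hA0 : 0 < A := by positivity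
  set J : ℝ := ∫ x in Set.Icc (-1) 1, arcsineMajorant x with hJ
  have hJ0 : 0 ≤ J := by
    refine integral_nonneg_of_ae ?_
    filter_upwards [ae_mem_Ioo_restrict_Icc] with x hx
    have h1 : 0 < 1 - x := by linarith [hx.2]
    have h2 : 0 < 1 + x := by linarith [hx.1]
    simp only [Pi.zero_apply, arcsineMajorant]
    positivity
  -- The summand `1` only serves to make the constant positive.
  refine ⟨A * C ^ 2 * J + 1, c, by positivity, hc, fun n hn => ?_⟩
  obtain ⟨hup, hlow⟩ := h n (shiftedJacobi α β n) hn (isHypergeometric_shiftedJacobi_half α β n)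
  rw [abs_coeff_zero_shiftedJacobi hα] at hup hlow
  refine ⟨?_, hlow⟩
  have hbound : jacobiNormSq α β n ≤ ∫ x in Set.Icc (-1) 1,
      A * C ^ 2 * jacobiSize α β n ^ 2 * arcsineMajorant x := by
    rw [jacobiNormSq, integral_jacobiMeasure]
    refine integral_mono_of_nonneg ?_ (integrableOn_arcsineMajorant.const_mul _) ?_
    · filter_upwards [ae_mem_Ioo_restrict_Icc] with x hx
      exact mul_nonneg (sq_nonneg _) (weight_nonneg α β hx)
    · filter_upwards [ae_mem_Ioo_restrict_Icc] with x hx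
      have h1 : 0 < 1 - x := by linarith [hx.2]
      have h2 : 0 < 1 + x := by linarith [hx.1]
      have hmem : Real.arccos x ∈ Set.Ioo 0 Real.pi :=
        ⟨Real.arccos_pos.2 hx.2, lt_of_le_of_ne (Real.arccos_le_pi x) fun h => by
          rw [Real.arccos_eq_pi] at h; linarith [hx.1]⟩
      have h3 := hup _ hmem
      have h4 : jacobiWave (α + 1 / 2) (β + 1 / 2) (shiftedJacobi α β n) (Real.arccos x) ^ 2
          ≤ (C * jacobiSize α β n) ^ 2 := by
        rw [← sq_abs]
        exact pow_le_pow_left₀ (abs_nonneg _) h3 2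
      rw [jacobiWave_arccos_sq n hx]
      calc _ ≤ A * (C * jacobiSize α β n) ^ 2 * arcsineMajorant x := by
            gcongr
            exact mul_rpow_neg_half_le hx
        _ = _ := by ring
  rw [integral_const_mul] at hbound
  refine hbound.trans ?_
  nlinarith [sq_nonneg (jacobiSize α β n)]

/-- A set of positive measure in `[-1, 1]` contains the cosines of a set of positive measure of
angles that keep away from `0` and `π`. -/
lemma exists_volume_angles_ne_zero {B : Set ℝ} (hB : B ⊆ Set.Icc (-1) 1) (hpos : volume B ≠ 0) :
    ∃ ε, 0 < ε ∧ ε < Real.pi / 2 ∧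
      volume {θ | θ ∈ Set.Icc ε (Real.pi - ε) ∧ Real.cos θ ∈ B} ≠ 0 := by
  by_contra! hcon
  have hk : ∀ k : ℕ, (0 : ℝ) < 1 / (k + 1) ∧ (1 : ℝ) / (k + 1) < Real.pi / 2 := by
    intro k
    refine ⟨by positivity, ?_⟩
    have h1 : (1 : ℝ) / (k + 1) ≤ 1 := by
      rw [div_le_one (by positivity)]
      linarith [(k.cast_nonneg : (0 : ℝ) ≤ k)]
    linarith [Real.pi_gt_three]
  -- The cosine maps null sets to null sets.
  have hnull : volume (⋃ k : ℕ, {θ | θ ∈ Set.Icc ((1 : ℝ) / (k + 1)) (Real.pi - 1 / (k + 1)) ∧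
      Real.cos θ ∈ B}) = 0 :=
    measure_iUnion_null fun k => hcon _ (hk k).1 (hk k).2
  have himage := addHaar_image_eq_zero_of_differentiableOn_of_addHaar_eq_zero volume
    (Real.differentiable_cos.differentiableOn) hnull
  refine hpos (measure_mono_null (t := (Real.cos '' (⋃ k : ℕ, {θ | θ ∈
    Set.Icc ((1 : ℝ) / (k + 1)) (Real.pi - 1 / (k + 1)) ∧ Real.cos θ ∈ B})) ∪ {-1, 1}) ?_ ?_)
  · intro x hx
    obtain ⟨h1, h2⟩ := hB hx
    rcases h1.eq_or_lt with rfl | h1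
    · simp
    rcases h2.eq_or_lt with rfl | h2
    · simp
    left
    have hpi : 0 < Real.pi - Real.arccos x := by
      have := lt_of_le_of_ne (Real.arccos_le_pi x) fun h => by
        rw [Real.arccos_eq_pi] at h; linarith
      linarith
    obtain ⟨k, hk'⟩ := exists_nat_one_div_lt (lt_min (Real.arccos_pos.2 h2) hpi)
    have hcos : Real.cos (Real.arccos x) = x := Real.cos_arccos h1.le h2.le
    refine ⟨Real.arccos x, Set.mem_iUnion.2 ⟨k, ⟨?_, ?_⟩, ?_⟩, hcos⟩
    · exact (hk'.trans_le (min_le_left _ _)).le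
    · linarith [hk'.trans_le (min_le_right _ _)]
    · rwa [hcos]
  · rw [measure_union_null_iff]
    exact ⟨himage, (Set.toFinite _).measure_zero _⟩

/-- If the terms of a Jacobi expansion are `O(n ^ δ)` uniformly on a set of positive measure, then
so are its coefficients, up to the size of the polynomials: an analogue of the Cantor–Lebesgue
theorem. -/
lemma exists_abs_jacobiCoeff_le (hα : -1 / 2 ≤ α) (hβ : -1 / 2 ≤ β) {f : ℝ → ℝ} {δ M : ℝ}
    {B : Set ℝ} (hB : B ⊆ Set.Icc (-1) 1) (hBm : MeasurableSet B) (hpos : volume B ≠ 0)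
    (hterm : ∀ x ∈ B, ∀ n : ℕ, |jacobiTerm α β f x n| ≤ M * ((n : ℝ) + 1) ^ δ) :
    ∃ C, ∃ n₀ : ℕ, ∀ n, n₀ ≤ n →
      |jacobiCoeff α β f n| ≤ C * (((n : ℝ) + 1) ^ δ * jacobiSize α β n) := by
  obtain ⟨ε, hε, hε', hvol⟩ := exists_volume_angles_ne_zero hB hpos
  set S : Set ℝ := {θ | θ ∈ Set.Icc ε (Real.pi - ε) ∧ Real.cos θ ∈ B} with hS
  have hSm : MeasurableSet S :=
    measurableSet_Icc.inter (Real.measurable_cos hBm)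
  obtain ⟨N₀, hN₀⟩ := eventually_amplitude_le
    (K := |(α + 1 / 2) - (α + 1 / 2) ^ 2| + |(β + 1 / 2) - (β + 1 / 2) ^ 2|) (by positivity)
    hε hε' hSm (fun θ hθ => hθ.1) hvol
  obtain ⟨C, c, hC, hc, hsize⟩ := exists_jacobiNormSq_le hα hβ
  obtain ⟨x₀, hx₀⟩ := nonempty_of_measure_ne_zero hpos
  have hM : 0 ≤ M := by
    have := (abs_nonneg _).trans (hterm x₀ hx₀ 0)
    simpa using this
  obtain ⟨n₁, hn₁⟩ := exists_nat_ge N₀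
  refine ⟨4 * M * C / c, max n₁ 1, fun n hn => ?_⟩
  have hn1 : 1 ≤ n := (le_max_right _ _).trans hn
  have hnN : N₀ ≤ jacobiFrequency α β n := by
    have h1 : (n₁ : ℝ) ≤ n := by exact_mod_cast (le_max_left _ _).trans hn
    rw [jacobiFrequency, frequency]
    linarith
  have hN1 := one_le_jacobiFrequency hα hβ hn1
  have hD := jacobiSize_pos hα hβ hn1
  have hh := jacobiNormSq_pos hα hβ hn1
  obtain ⟨hnorm, hamp⟩ := hsize n hn1
  rcases eq_or_ne (jacobiCoeff α β f n) 0 with h0 | h0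
  · rw [h0, abs_zero]
    positivity
  -- `κ` times the wave is bounded by the term of the expansion at `cos θ`.
  set κ := |jacobiCoeff α β f n| * (jacobiNormSq α β n)⁻¹ with hκ
  have hκ0 : 0 < κ := by positivity
  have hosc := isOscillation_jacobiWave (isHypergeometric_shiftedJacobi_half α β n)
    (eigenvalue_add_eq_sq_frequency (α + 1 / 2) (β + 1 / 2) n)
  have hsmall : ∀ θ ∈ S, |jacobiWave (α + 1 / 2) (β + 1 / 2) (shiftedJacobi α β n) θ|
      ≤ M * ((n : ℝ) + 1) ^ δ / κ := by
    intro θ hθ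
    have hmem : θ ∈ Set.Ioo 0 Real.pi := (abs_cot_le_of_mem_Icc hε hε' hθ.1).1
    have hs := sin_half_pos hmem
    have hcs := cos_half_pos hmem
    have hx : 1 - 2 * Real.sin (θ / 2) ^ 2 = Real.cos θ := by
      have h3 := Real.cos_two_mul (θ / 2)
      rw [mul_div_cancel₀ _ two_ne_zero] at h3
      rw [h3, Real.cos_sq']; ring
    rw [le_div_iff₀ hκ0, jacobiWave, eval_shiftedJacobi, hx, abs_mul,
      abs_of_nonneg (by positivity)]
    have h1 : Real.sin (θ / 2) ^ (α + 1 / 2) * Real.cos (θ / 2) ^ (β + 1 / 2) ≤ 1 := by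
      refine mul_le_one₀ (Real.rpow_le_one hs.le (Real.sin_le_one _) (by linarith))
        (by positivity) (Real.rpow_le_one hcs.le (Real.cos_le_one _) (by linarith))
    have h2 := hterm _ hθ.2 n
    rw [jacobiTerm, abs_mul, abs_mul, abs_of_pos (inv_pos.2 hh)] at h2
    refine le_trans ?_ h2
    calc _ ≤ 1 * |(jacobiPoly α β n).eval (Real.cos θ)| * κ := by gcongr
      _ = _ := by rw [hκ]; ring
  have hmain := hamp.trans (hN₀ _ _ _ _ hnN hosc _ hsmall)
  have h1 : c * jacobiSize α β n ≤ 4 * (M * ((n : ℝ) + 1) ^ δ / κ) := by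
    refine le_of_mul_le_mul_left ?_ (by linarith : 0 < jacobiFrequency α β n)
    rw [jacobiFrequency] at hmain ⊢
    linarith
  have h2 : κ * (c * jacobiSize α β n) ≤ 4 * (M * ((n : ℝ) + 1) ^ δ) := by
    have := mul_le_mul_of_nonneg_left h1 hκ0.le
    rwa [show κ * (4 * (M * ((n : ℝ) + 1) ^ δ / κ)) = 4 * (M * ((n : ℝ) + 1) ^ δ) by
      field_simp] at this
  have h3 : |jacobiCoeff α β f n| = κ * jacobiNormSq α β n := by
    rw [hκ]; field_simp
  have h4 : |jacobiCoeff α β f n| * c ≤ 4 * M * C * (((n : ℝ) + 1) ^ δ * jacobiSize α β n) := by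
    calc |jacobiCoeff α β f n| * c ≤ κ * (C * jacobiSize α β n ^ 2) * c := by
          rw [h3]; gcongr
      _ = C * jacobiSize α β n * (κ * (c * jacobiSize α β n)) := by ring
      _ ≤ C * jacobiSize α β n * (4 * (M * ((n : ℝ) + 1) ^ δ)) := by gcongr
      _ = _ := by ring
  rw [div_mul_eq_mul_div, le_div_iff₀ hc]
  exact h4

/-! ### A function with large coefficients -/

/-- Pairing with a function that is continuous on the unit interval, as a functional on `L^p` of a
finite measure carried by that interval. -/
lemma exists_clm_eq_integral_mul (μ : Measure ℝ) [IsFiniteMeasure μ] (P : ENNReal)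
    [Fact (1 ≤ P)] {φ : ℝ → ℝ} (hφ : Continuous φ) :
    ∃ T : Lp ℝ P (μ.restrict (Set.Icc 0 1)) →L[ℝ] ℝ,
      ∀ g, T g = ∫ x in Set.Icc 0 1, g x * φ x ∂μ := by
  have hconj : ENNReal.HolderConjugate P (ENNReal.conjExponent P) :=
    ENNReal.HolderConjugate.conjExponent Fact.out
  have : Fact (1 ≤ ENNReal.conjExponent P) := ⟨ENNReal.HolderConjugate.one_le _ P⟩
  obtain ⟨C, hC⟩ := (isCompact_Icc (a := (0 : ℝ)) (b := 1)).exists_bound_of_continuousOn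
    hφ.continuousOn
  have hmem : MemLp φ (ENNReal.conjExponent P) (μ.restrict (Set.Icc 0 1)) := by
    refine MemLp.of_bound hφ.aestronglyMeasurable C ?_
    filter_upwards [ae_restrict_mem measurableSet_Icc] with x hx using hC x hx
  refine ⟨((ContinuousLinearMap.mul ℝ ℝ).lpPairing (μ.restrict (Set.Icc 0 1)) P
    (ENNReal.conjExponent P)).flip (hmem.toLp φ), fun g => ?_⟩
  rw [ContinuousLinearMap.flip_apply, ContinuousLinearMap.lpPairing_eq_integral]
  refine integral_congr_ae ?_
  filter_upwards [hmem.coeFn_toLp] with x hx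
  rw [hx, ContinuousLinearMap.mul_apply']

/-- What a bound for the norm of the functional `g ↦ ∫ g P_n dμ` by `C * jacobiSize α β n` entails
for `C`, after dividing by `P_n(1)`: the functional is tested on the indicator function of an
interval of length comparable with `n⁻²` next to the point `1`. -/
lemma rpow_le_of_opNorm_le (hα : -1 / 2 ≤ α) (hβ : -1 / 2 ≤ β) {p : ℝ} (hp : 1 ≤ p)
    [IsFiniteMeasure (jacobiMeasure α β)] [Fact (1 ≤ ENNReal.ofReal p)] {n : ℕ} (hn : 1 ≤ n)
    {T : Lp ℝ (ENNReal.ofReal p) ((jacobiMeasure α β).restrict (Set.Icc 0 1)) →L[ℝ] ℝ}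
    (hT : ∀ g, T g = ∫ x in Set.Icc 0 1, g x * (jacobiPoly α β n).eval x ∂(jacobiMeasure α β))
    {C : ℝ} (hC : ‖T‖ ≤ C * jacobiSize α β n) :
    (((1 / (3 * jacobiFrequency α β n)) ^ 2) ^ (α + 1) / 2) ^ (1 - 1 / p)
      ≤ 2 * C * (1 / (3 * jacobiFrequency α β n)) ^ (α + 1 / 2) := by
  have hN := one_le_jacobiFrequency hα hβ hn
  obtain ⟨hs0, hs1⟩ := inv_three_mul_mem hN
  have hP1 := eval_one_jacobiPoly_pos (by linarith : -1 < α) β n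
  set s := 1 / (3 * jacobiFrequency α β n) with hs
  set η := s ^ 2 with hη
  have hη0 : 0 < η := by positivity
  have hη1 : η ≤ 1 / 2 := by rw [hη]; nlinarith
  set S : Set ℝ := Set.Icc (1 - 2 * η) (1 - η) with hS
  have hSsub : S ⊆ Set.Icc 0 1 := Set.Icc_subset_Icc (by linarith) (by linarith)
  have hSm : MeasurableSet S := measurableSet_Icc
  set m := (jacobiMeasure α β S).toReal with hm
  have hmass : η ^ (α + 1) / 2 ≤ m :=
    (ENNReal.ofReal_le_iff_le_toReal (measure_ne_top _ _)).1
      (ofReal_le_jacobiMeasure_Icc hα hβ hη0 hη1)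
  have hm0 : 0 < m := lt_of_lt_of_le (by positivity) hmass
  have hrestrict : ((jacobiMeasure α β).restrict (Set.Icc 0 1)) S = jacobiMeasure α β S := by
    rw [Measure.restrict_apply hSm, Set.inter_eq_self_of_subset_left hSsub]
  have hStop : ((jacobiMeasure α β).restrict (Set.Icc 0 1)) S ≠ ⊤ := measure_ne_top _ _
  set g := indicatorConstLp (ENNReal.ofReal p) hSm hStop (1 : ℝ) with hg
  have hp0 : 0 < p := by linarith
  have hgnorm : ‖g‖ = m ^ (1 / p) := by
    rw [hg, norm_indicatorConstLp (by simpa using hp0) ENNReal.ofReal_ne_top, norm_one, one_mul,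
      ENNReal.toReal_ofReal hp0.le, Measure.real, hrestrict]
  have hTg : (jacobiPoly α β n).eval 1 / 2 * m ≤ T g := by
    have h1 : T g = ∫ x in S, (jacobiPoly α β n).eval x ∂(jacobiMeasure α β) := by
      rw [hT g]
      have h2 : ∫ x in Set.Icc 0 1, g x * (jacobiPoly α β n).eval x ∂(jacobiMeasure α β)
          = ∫ x in Set.Icc 0 1, S.indicator (fun x => (jacobiPoly α β n).eval x) x ∂(jacobiMeasure α β) := by
        refine integral_congr_ae ?_
        filter_upwards [indicatorConstLp_coeFn (p := ENNReal.ofReal p) (hs := hSm)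
          (hμs := hStop) (c := (1 : ℝ))] with x hx
        rw [hg, hx]
        by_cases hxS : x ∈ S <;> simp [hxS]
      rw [h2, integral_indicator hSm, Measure.restrict_restrict hSm,
        Set.inter_eq_self_of_subset_left hSsub]
    rw [h1]
    have hint : IntegrableOn (fun x => (jacobiPoly α β n).eval x) S (jacobiMeasure α β) :=
      (integrable_of_continuous_jacobiMeasure hα hβ (jacobiPoly α β n).continuous).integrableOn
    have h3 := setIntegral_mono_on (integrableOn_const (measure_ne_top (jacobiMeasure α β) S)) hint hSm
      (fun x hx => half_eval_one_le_eval_jacobiPoly hα hβ hn (by linarith [hx.2] : x ≤ 1) hx.1)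
    rw [setIntegral_const, smul_eq_mul] at h3
    rwa [mul_comm]
  have hle : (jacobiPoly α β n).eval 1 / 2 * m ≤ C * jacobiSize α β n * m ^ (1 / p) := by
    refine hTg.trans ((le_abs_self _).trans ((T.le_opNorm g).trans ?_))
    rw [hgnorm]
    gcongr
  have hsplit : m = m ^ (1 - 1 / p) * m ^ (1 / p) := by
    rw [← Real.rpow_add hm0, sub_add_cancel, Real.rpow_one]
  have hmp : 0 < m ^ (1 / p) := by positivity
  have hexp : 0 ≤ 1 - 1 / p := by
    rw [sub_nonneg, div_le_one hp0]; exact hp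
  have h1 : (jacobiPoly α β n).eval 1 * m ^ (1 - 1 / p)
      ≤ (jacobiPoly α β n).eval 1 * (2 * C * s ^ (α + 1 / 2)) := by
    refine le_of_mul_le_mul_right ?_ hmp
    rw [mul_assoc, ← hsplit]
    rw [jacobiSize, ← hs] at hle
    linarith
  exact (Real.rpow_le_rpow (by positivity) hmass hexp).trans (le_of_mul_le_mul_left h1 hP1)

/-- By the principle of uniform boundedness some `g ∈ L^p`, carried by the unit interval, has
coefficients that are not `O(n ^ δ)` relative to the size of the polynomials. -/
lemma exists_memLp_not_abs_jacobiCoeff_le (hα : -1 / 2 ≤ α) (hβ : -1 / 2 ≤ β) {p δ : ℝ}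
    (hp : 1 ≤ p) (hδ : 0 ≤ δ) (hδp : δ < (2 * α + 2) / p - (2 * α + 3) / 2) :
    ∃ f : ℝ → ℝ, MemLp f (ENNReal.ofReal p) (jacobiMeasure α β) ∧
      Function.support f ⊆ Set.Icc 0 1 ∧
      ¬ ∃ C, ∃ n₀ : ℕ, ∀ n, n₀ ≤ n →
        |jacobiCoeff α β f n| ≤ C * (((n : ℝ) + 1) ^ δ * jacobiSize α β n) := by
  have := isFiniteMeasure_jacobiMeasure hα hβ
  have : Fact (1 ≤ ENNReal.ofReal p) := ⟨by simpa using hp⟩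
  set μ := jacobiMeasure α β with hμ
  choose T hT using fun n : ℕ =>
    exists_clm_eq_integral_mul μ (ENNReal.ofReal p) (jacobiPoly α β n).continuous
  by_contra! hcon
  -- The degree is shifted by one because the size estimates start at degree one.
  set d : ℕ → ℝ := fun n => (((n + 1 : ℕ) : ℝ) + 1) ^ δ * jacobiSize α β (n + 1) with hd
  have hd0 : ∀ n, 0 < d n := fun n => by
    have := jacobiSize_pos hα hβ (Nat.le_add_left 1 n)
    positivity
  have hpt : ∀ g, ∃ C, ∀ n : ℕ, ‖((d n)⁻¹ • T (n + 1)) g‖ ≤ C := by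
    intro g
    obtain ⟨C, n₀, hC⟩ := hcon ((Set.Icc 0 1).indicator g)
      ((memLp_indicator_iff_restrict measurableSet_Icc).2 (Lp.memLp g))
      Set.support_indicator_subset
    refine ⟨C + ∑ n ∈ Finset.range n₀, ‖((d n)⁻¹ • T (n + 1)) g‖ + |C|, fun n => ?_⟩
    have hsum : 0 ≤ ∑ n ∈ Finset.range n₀, ‖((d n)⁻¹ • T (n + 1)) g‖ :=
      Finset.sum_nonneg fun _ _ => norm_nonneg _
    rcases lt_or_ge n n₀ with hn | hn
    · have := Finset.single_le_sum (f := fun n => ‖((d n)⁻¹ • T (n + 1)) g‖)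
        (fun _ _ => norm_nonneg _) (Finset.mem_range.2 hn)
      linarith [neg_abs_le C]
    · have h1 := hC (n + 1) (by omega)
      have h2 : jacobiCoeff α β ((Set.Icc 0 1).indicator g) (n + 1) = T (n + 1) g := by
        rw [hT, jacobiCoeff, ← integral_indicator measurableSet_Icc]
        congr 1 with x
        by_cases hx : x ∈ Set.Icc (0 : ℝ) 1 <;> simp only [hx, Set.indicator_of_mem,
          Set.indicator_of_notMem, not_false_eq_true, zero_mul]
      rw [h2] at h1
      have h3 : ‖((d n)⁻¹ • T (n + 1)) g‖ ≤ C := by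
        rw [smul_apply, norm_smul, norm_inv, Real.norm_of_nonneg (hd0 n).le,
          inv_mul_le_iff₀ (hd0 n), mul_comm]
        exact h1
      linarith [abs_nonneg C]
  obtain ⟨C, hC⟩ := banach_steinhaus hpt
  have hC0 : 0 ≤ C := (norm_nonneg _).trans (hC 0)
  -- Positivity of this exponent is the assumption on `δ`.
  have hexp : 0 < α + 1 / 2 - δ - 2 * (α + 1) * (1 - 1 / p) := by
    have : 2 * (α + 1) * (1 - 1 / p) = 2 * α + 2 - (2 * α + 2) / p := by ring
    rw [this]
    linarith
  set e := α + 1 / 2 - δ - 2 * (α + 1) * (1 - 1 / p) with he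
  have hbound : ∀ n : ℕ, (3 * jacobiFrequency α β (n + 1)) ^ e
      ≤ 2 * C * 2 ^ (1 - 1 / p) := by
    intro n
    have hN := one_le_jacobiFrequency hα hβ (Nat.le_add_left 1 n)
    set y := 3 * jacobiFrequency α β (n + 1) with hy
    have hy0 : 0 < y := by linarith
    have hny : ((n + 1 : ℕ) : ℝ) + 1 ≤ y := by
      rw [hy, jacobiFrequency, frequency]
      push_cast
      linarith [(n.cast_nonneg : (0 : ℝ) ≤ n)]
    have hnorm : ‖T (n + 1)‖ ≤ C * y ^ δ * jacobiSize α β (n + 1) := by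
      have h1 := hC n
      rw [norm_smul, norm_inv, Real.norm_of_nonneg (hd0 n).le, inv_mul_le_iff₀ (hd0 n)] at h1
      have h2 : (((n + 1 : ℕ) : ℝ) + 1) ^ δ ≤ y ^ δ := Real.rpow_le_rpow (by positivity) hny hδ
      have h3 := jacobiSize_pos hα hβ (Nat.le_add_left 1 n)
      calc _ ≤ d n * C := h1
        _ ≤ y ^ δ * jacobiSize α β (n + 1) * C := by
          simp only [hd]; gcongr
        _ = _ := by ring
    have h4 := rpow_le_of_opNorm_le hα hβ hp (Nat.le_add_left 1 n) (hT (n + 1)) hnorm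
    rw [← hy] at h4
    -- all quantities are powers of `y`
    have e1 : ((1 / y) ^ 2) ^ (α + 1) = y ^ (-(2 * (α + 1))) := by
      rw [one_div, inv_pow, ← Real.rpow_natCast, ← Real.rpow_neg hy0.le, ← Real.rpow_mul hy0.le]
      congr 1
      push_cast
      ring
    have e2 : (1 / y) ^ (α + 1 / 2) = y ^ (-(α + 1 / 2)) := by
      rw [one_div, Real.inv_rpow hy0.le, Real.rpow_neg hy0.le]
    rw [e1, e2, Real.div_rpow (by positivity) zero_le_two, ← Real.rpow_mul hy0.le,
      div_le_iff₀ (by positivity)] at h4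
    have e3 : y ^ e = y ^ (-(2 * (α + 1)) * (1 - 1 / p)) * y ^ (α + 1 / 2 - δ) := by
      rw [← Real.rpow_add hy0, he]
      congr 1
      ring
    have e4 : y ^ δ * y ^ (-(α + 1 / 2)) * y ^ (α + 1 / 2 - δ) = 1 := by
      rw [← Real.rpow_add hy0, ← Real.rpow_add hy0]
      ring_nf
      exact Real.rpow_zero y
    have hpos : 0 ≤ y ^ (α + 1 / 2 - δ) := by positivity
    calc y ^ e ≤ 2 * (C * y ^ δ) * y ^ (-(α + 1 / 2)) * 2 ^ (1 - 1 / p) * y ^ (α + 1 / 2 - δ) := by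
          rw [e3]; gcongr
      _ = 2 * C * 2 ^ (1 - 1 / p) * (y ^ δ * y ^ (-(α + 1 / 2)) * y ^ (α + 1 / 2 - δ)) := by ring
      _ = _ := by rw [e4, mul_one]
  have hlim : Tendsto (fun n : ℕ => (3 * jacobiFrequency α β (n + 1)) ^ e) atTop atTop := by
    refine (tendsto_rpow_atTop hexp).comp ?_
    refine tendsto_atTop_mono (fun n : ℕ => ?_) tendsto_natCast_atTop_atTop
    rw [jacobiFrequency, frequency]
    push_cast
    linarith [(n.cast_nonneg : (0 : ℝ) ≤ n)]
  obtain ⟨n, hn⟩ := (hlim.eventually_gt_atTop (2 * C * 2 ^ (1 - 1 / p))).exists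
  exact (hbound n).not_gt hn

/-! ### Divergence almost everywhere -/

/-- When the coefficients are not `O(n ^ δ)` relative to the size of the polynomials, the points at
which the terms of the expansion are `O(n ^ δ)` form a null set. -/
lemma ae_not_exists_abs_jacobiTerm_le (hα : -1 / 2 ≤ α) (hβ : -1 / 2 ≤ β) {f : ℝ → ℝ} {δ : ℝ}
    (hf : ¬ ∃ C, ∃ n₀ : ℕ, ∀ n, n₀ ≤ n →
        |jacobiCoeff α β f n| ≤ C * (((n : ℝ) + 1) ^ δ * jacobiSize α β n)) :
    ∀ᵐ x ∂(volume.restrict (Set.Icc (-1 : ℝ) 1)),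
      ¬ ∃ M, ∀ n : ℕ, |jacobiTerm α β f x n| ≤ M * ((n : ℝ) + 1) ^ δ := by
  set B : ℕ → Set ℝ := fun k => Set.Icc (-1 : ℝ) 1 ∩
    ⋂ n : ℕ, {x | |jacobiTerm α β f x n| ≤ k * ((n : ℝ) + 1) ^ δ} with hB
  have hBm : ∀ k, MeasurableSet (B k) := by
    intro k
    refine measurableSet_Icc.inter (MeasurableSet.iInter fun n => measurableSet_le ?_ ?_)
    · have : Continuous fun x => |jacobiTerm α β f x n| :=
        (continuous_const.mul (jacobiPoly α β n).continuous).abs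
      exact this.measurable
    · exact measurable_const
  have hBnull : ∀ k, volume (B k) = 0 := by
    intro k
    by_contra hpos
    exact hf (exists_abs_jacobiCoeff_le hα hβ (fun x hx => hx.1) (hBm k) hpos
      fun x hx n => Set.mem_iInter.1 hx.2 n)
  rw [ae_restrict_iff' measurableSet_Icc]
  have hunion := measure_iUnion_null hBnull
  rw [ae_iff]
  refine measure_mono_null (fun x hx => ?_) hunion
  obtain ⟨hx1, hx2⟩ := Classical.not_imp.1 hx
  obtain ⟨M, hM⟩ := not_not.1 hx2
  obtain ⟨k, hk⟩ := exists_nat_ge M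
  exact Set.mem_iUnion.2 ⟨k, hx1, Set.mem_iInter.2 fun n => (hM n).trans (by gcongr)⟩

end JacobiExpansion

theorem mainTheorem1 (α β p δ : ℝ) (hβ : -1 / 2 ≤ β) (hβα : β ≤ α) (hα : -1 / 2 < α)
    (hp : 1 ≤ p) (hpc : p < 4 * (α + 1) / (2 * α + 3))
    (hδ : 0 ≤ δ) (hδp : δ < (2 * α + 2) / p - (2 * α + 3) / 2) :
    ∃ f : ℝ → ℝ,
      MemLp f (ENNReal.ofReal p) (JacobiExpansion.jacobiMeasure α β) ∧
      Function.support f ⊆ Set.Icc 0 1 ∧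
      (∀ᵐ x ∂(volume.restrict (Set.Icc (-1 : ℝ) 1)),
        ¬ ∃ l : ℝ, Tendsto
          (fun N : ℕ => JacobiExpansion.cesaroMean δ (JacobiExpansion.jacobiTerm α β f x) N)
          atTop (𝓝 l)) ∧
      (∀ᵐ x ∂(volume.restrict (Set.Icc (-1 : ℝ) 1)),
        ¬ ∃ l : ℝ, Tendsto
          (fun r : ℝ => JacobiExpansion.rieszMean δ (JacobiExpansion.jacobiTerm α β f x) r)
          atTop (𝓝 l)) := by
  obtain ⟨f, hfp, hsupp, hcoeff⟩ := JacobiExpansion.exists_memLp_not_abs_jacobiCoeff_le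
    hα.le hβ hp hδ hδp
  have hae := JacobiExpansion.ae_not_exists_abs_jacobiTerm_le hα.le hβ hcoeff
  refine ⟨f, hfp, hsupp, ?_, ?_⟩
  · filter_upwards [hae] with x hx
    rintro ⟨l, hl⟩
    exact hx (JacobiExpansion.exists_abs_le_of_tendsto_cesaroMean hδ hl)
  · filter_upwards [hae] with x hx
    rintro ⟨l, hl⟩
    exact hx (JacobiExpansion.exists_abs_le_of_tendsto_rieszMean hδ hl)
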